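/- Let $n\ge 2$. Let $G$ be a holomorphic automorphism of $\mathbb{C}^n$ with $G(O)=O$ which is expanding, i.e. the iterates $G^{-k}$ converge to $O$ uniformly on compact subsets of $\mathbb{C}^n$ as $k\to\infty$. Let $\varphi\in \mathit{Diff}^{\,\infty}([0,\infty))$ be a diffeomorphism which is tangent to the identity to infinite order at $0$ and satisfies $\varphi(x)>x$ for all $x>0$. Put $\tilde R=(\mathbb{C}^n\times[0,\infty))\setminus\{(O,0)\}$ and $T=G\times\varphi:\tilde R\to\tilde R$, and let $R=\tilde R/T^{\mathbb{Z}}$ be the quotient, with the foliation whose leaves are the images of the sets $(\mathbb{C}^n\times\{x\})\cap\tilde R$, $x\geq 0$, and the leafwise complex structure induced from $\mathbb{C}^n$. Its boundary is the Hopf manifold $H=(\mathbb{C}^n\setminus\{O\})/G^{\mathbb{Z}}$, included in $R$ by $[z]\mapsto[(z,0)]$. Let $\mathrm{Aut}\,R$ be the group of diffeomorphisms of $R$ that preserve the foliation and map leaves biholomorphically onto leaves, and let $\mathrm{Aut}\,H$ be the group of biholomorphic maps $H\to H$. Then every $f\in\mathrm{Aut}\,R$ restricts to an element $r_H(f)$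 of $\mathrm{Aut}\,H$, and the restriction homomorphism $r_H:\mathrm{Aut}\,R\to\mathrm{Aut}\,H$ is surjective. -/

import Mathlib

open Set Filter Topology TopologicalSpace
open scoped Manifold ContDiff NNReal

noncomputable section

/-! ### Automorphism groups of manifolds with a structure groupoid -/

/-- The tautological action of the group of self-homeomorphisms of `X` on `X`. -/
instance homeoMulAction (X : Type*) [TopologicalSpace X] : MulAction (X ≃ₜ X) X where
  smul f x := f x
  one_smul _ := rfl
  mul_smul _ _ _ := rfl

theorem homeo_smul_def {X : Type*} [TopologicalSpace X] (f : X ≃ₜ X) (x : X) : f • x = f x := rfl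

/-- The group of all self-homeomorphisms of `M` which, read in the charts of `M`, belong to the
structure groupoid `𝒢` (that is, the group of self-structomorphisms of `M`). -/
def structureAut {H₀ : Type*} [TopologicalSpace H₀] (𝒢 : StructureGroupoid H₀)
    (M : Type*) [TopologicalSpace M] [ChartedSpace H₀ M] [HasGroupoid M 𝒢] :
    Subgroup (M ≃ₜ M) where
  carrier := {f | ∀ c ∈ atlas H₀ M, ∀ c' ∈ atlas H₀ M,
    c.symm ≫ₕ f.toOpenPartialHomeomorph ≫ₕ c' ∈ 𝒢}
  one_mem' c hc c' hc' := (Structomorph.refl (G := 𝒢) M).mem_groupoid c c' hc hc'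
  mul_mem' {f g} hf hg c hc c' hc' :=
    (Structomorph.trans (G := 𝒢) ⟨g, fun c c' hc hc' => hg c hc c' hc'⟩
      ⟨f, fun c c' hc hc' => hf c hc c' hc'⟩).mem_groupoid c c' hc hc'
  inv_mem' {f} hf c hc c' hc' :=
    (Structomorph.symm (G := 𝒢) ⟨f, fun c c' hc hc' => hf c hc c' hc'⟩).mem_groupoid c c' hc hc'

/-- The group of biholomorphic self-maps of a complex manifold `M` modelled on `E`. -/
def holomorphicAut (E : Type*) [NormedAddCommGroup E] [NormedSpace ℂ E]
    (M : Type*) [TopologicalSpace M] [ChartedSpace E M] : Subgroup (M ≃ₜ M) where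
  carrier := {f | ContMDiff 𝓘(ℂ, E) 𝓘(ℂ, E) ω f ∧ ContMDiff 𝓘(ℂ, E) 𝓘(ℂ, E) ω f.symm}
  one_mem' := ⟨contMDiff_id, contMDiff_id⟩
  mul_mem' {_ _} hf hg := ⟨hf.1.comp hg.1, hg.2.comp hf.2⟩
  inv_mem' {_} hf := ⟨hf.2, hf.1⟩

/-! ### Leafwise complex foliations of codimension one, on manifolds with boundary -/

/-- The half line `[0, ∞)` as a one-dimensional manifold with boundary. -/
def halfLine : ModelWithCorners ℝ ℝ ℝ≥0 :=
  ModelWithCorners.ofConvexRange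
    { toFun := fun x => (x : ℝ)
      invFun := Real.toNNReal
      source := univ
      target := Ici 0
      map_source' := fun x _ => x.2
      map_target' := fun _ _ => mem_univ _
      left_inv' := fun _ _ => Real.toNNReal_coe
      right_inv' := fun x hx => Real.coe_toNNReal x hx }
    rfl (convex_Ici 0) NNReal.continuous_coe continuous_real_toNNReal
    (by rw [interior_Ici]; exact ⟨1, one_pos (α := ℝ)⟩)

/-- `E × [0, ∞)` as a smooth real manifold with boundary, for a complex vector space `E`. -/
abbrev leafModel (E : Type*) [NormedAddCommGroup E] [NormedSpace ℂ E] :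
    ModelWithCorners ℝ (E × ℝ) (ModelProd E ℝ≥0) :=
  (𝓘(ℝ, E)).prod halfLine

theorem continuousOn_of_property {E : Type*} [NormedAddCommGroup E] [NormedSpace ℂ E]
    {f : ModelProd E ℝ≥0 → ModelProd E ℝ≥0} {u : Set (ModelProd E ℝ≥0)}
    (hf : (contDiffPregroupoid ∞ (leafModel E)).property f u) : ContinuousOn f u := by
  have h1 : ContinuousOn (leafModel E ∘ f ∘ (leafModel E).symm)
    ((leafModel E).symm ⁻¹' u ∩ range (leafModel E)) := ContDiffOn.continuousOn hf
  have hm : MapsTo (leafModel E) u ((leafModel E).symm ⁻¹' u ∩ range (leafModel E)) :=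
    fun x hx => ⟨by rw [mem_preimage, ModelWithCorners.left_inv]; exact hx, mem_range_self x⟩
  have h2 := (leafModel E).continuous_symm.comp_continuousOn
    (h1.comp (leafModel E).continuous.continuousOn hm)
  refine h2.congr fun x hx => ?_
  simp only [Function.comp_apply, ModelWithCorners.left_inv]

/-- The maps `(z, x) ↦ (w, y)` between open subsets of `E × [0, ∞)` which are smooth (up to the
boundary), for which `y` locally depends on `x` only, and for which `w` is holomorphic in `z` when
`x` is fixed. -/
def leafwisePregroupoid (E : Type*) [NormedAddCommGroup E] [NormedSpace ℂ E] :
    Pregroupoid (ModelProd E ℝ≥0) where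
  property f u :=
    (contDiffPregroupoid ∞ (leafModel E)).property f u ∧
    (∀ p ∈ u, ∃ v ∈ 𝓝 p, ∀ q ∈ v, ∀ q' ∈ v, q.2 = q'.2 → (f q).2 = (f q').2) ∧
    ∀ p ∈ u, DifferentiableAt ℂ (fun z => (f (z, p.2)).1) p.1
  comp {f g u v} hf hg hu hv huv := by
    refine ⟨(contDiffPregroupoid ∞ (leafModel E)).comp hf.1 hg.1 hu hv huv, ?_, ?_⟩
    · rintro p ⟨hpu, hpv⟩
      obtain ⟨a, ha, hfa⟩ := hf.2.1 p hpu
      obtain ⟨b, hb, hgb⟩ := hg.2.1 (f p) hpv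
      have hc := (continuousOn_of_property hf.1).continuousAt (hu.mem_nhds hpu)
      refine ⟨a ∩ f ⁻¹' b, inter_mem ha (hc hb), fun q hq q' hq' h => ?_⟩
      exact hgb _ hq.2 _ hq'.2 (hfa q hq.1 q' hq'.1 h)
    · rintro p ⟨hpu, hpv⟩
      obtain ⟨a, ha, hfa⟩ := hf.2.1 p hpu
      have h1 : ∀ᶠ z in 𝓝 p.1, (z, p.2) ∈ a := by
        have : ContinuousAt (fun z : E => ((z, p.2) : ModelProd E ℝ≥0)) p.1 := by
          exact (Continuous.prodMk_left p.2).continuousAt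
        exact this ha
      have h2 : (fun z => (g (f (z, p.2))).1) =ᶠ[𝓝 p.1]
          (fun w => (g (w, (f p).2)).1) ∘ (fun z => (f (z, p.2)).1) := by
        filter_upwards [h1] with z hz
        have := hfa (z, p.2) hz p (mem_of_mem_nhds ha) rfl
        change (g (f (z, p.2))).1 = (g ((f (z, p.2)).1, (f p).2)).1
        rw [← this]
        rfl
      refine DifferentiableAt.congr_of_eventuallyEq ?_ h2
      exact DifferentiableAt.comp p.1 (hg.2.2 (f p) hpv) (hf.2.2 p hpu)
  id_mem := by
    refine ⟨(contDiffPregroupoid ∞ (leafModel E)).id_mem, fun p _ => ?_, fun p _ => ?_⟩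
    · exact ⟨univ, univ_mem, fun _ _ _ _ h => h⟩
    · exact differentiableAt_id
  locality {f u} hu h := by
    refine ⟨(contDiffPregroupoid ∞ (leafModel E)).locality hu fun x hx => ?_,
      fun p hp => ?_, fun p hp => ?_⟩
    · obtain ⟨v, hv, hxv, h'⟩ := h x hx
      exact ⟨v, hv, hxv, h'.1⟩
    · obtain ⟨v, hv, hxv, h'⟩ := h p hp
      exact h'.2.1 p ⟨hp, hxv⟩
    · obtain ⟨v, hv, hxv, h'⟩ := h p hp
      exact h'.2.2 p ⟨hp, hxv⟩
  congr {f g u} hu hfg h := by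
    refine ⟨(contDiffPregroupoid ∞ (leafModel E)).congr hu hfg h.1, fun p hp => ?_, fun p hp => ?_⟩
    · obtain ⟨a, ha, hfa⟩ := h.2.1 p hp
      refine ⟨a ∩ u, inter_mem ha (hu.mem_nhds hp), fun q hq q' hq' e => ?_⟩
      rw [hfg q hq.2, hfg q' hq'.2]
      exact hfa q hq.1 q' hq'.1 e
    · refine (h.2.2 p hp).congr_of_eventuallyEq ?_
      have : ContinuousAt (fun z : E => ((z, p.2) : ModelProd E ℝ≥0)) p.1 := by
        exact (Continuous.prodMk_left p.2).continuousAt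
      filter_upwards [this (hu.mem_nhds hp)] with z hz
      rw [hfg _ hz]

/-- The structure groupoid on `E × [0, ∞)` of the leafwise complex structures of codimension one:
local diffeomorphisms of the form `(z, x) ↦ (w (z, x), y (x))`, with `w` holomorphic in `z`. A
manifold with an atlas in this groupoid is a foliated manifold whose leaves are complex manifolds
varying smoothly in the transverse direction; its automorphisms are the diffeomorphisms that
preserve the foliation and map leaves biholomorphically to leaves. -/
def leafwiseGroupoid (E : Type*) [NormedAddCommGroup E] [NormedSpace ℂ E] :
    StructureGroupoid (ModelProd E ℝ≥0) :=
  (leafwisePregroupoid E).groupoid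

instance (E : Type*) [NormedAddCommGroup E] [NormedSpace ℂ E] :
    ClosedUnderRestriction (leafwiseGroupoid E) where
  closedUnderRestriction {e} he s hs := by
    have mono : ∀ (f : ModelProd E ℝ≥0 → ModelProd E ℝ≥0) (u v : Set (ModelProd E ℝ≥0)),
        v ⊆ u → (leafwisePregroupoid E).property f u → (leafwisePregroupoid E).property f v :=
      fun f u v huv h => ⟨ContDiffOn.mono h.1 fun x hx => ⟨huv hx.1, hx.2⟩,
        fun p hp => h.2.1 p (huv hp), fun p hp => h.2.2 p (huv hp)⟩
    exact ⟨mono _ _ _ inter_subset_left he.1, mono _ _ _ inter_subset_left he.2⟩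

/-- The group of leafwise holomorphic smooth automorphisms of a manifold `M` (with boundary)
carrying a leafwise complex foliation of codimension one. -/
def leafwiseAut (E : Type*) [NormedAddCommGroup E] [NormedSpace ℂ E]
    (M : Type*) [TopologicalSpace M] [ChartedSpace (ModelProd E ℝ≥0) M]
    [HasGroupoid M (leafwiseGroupoid E)] : Subgroup (M ≃ₜ M) :=
  structureAut (leafwiseGroupoid E) M

/-! ### Quotients of punctured spaces by expanding homeomorphisms -/

section Punctured

variable {Y : Type*} [TopologicalSpace Y]

/-- A homeomorphism `F` expands from the point `p` if its backward iterates converge to `p`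
uniformly on compact sets. -/
def IsExpandingFrom (F : Y ≃ₜ Y) (p : Y) : Prop :=
  ∀ K : Set Y, IsCompact K → ∀ U ∈ 𝓝 p, ∀ᶠ k : ℕ in atTop, MapsTo (F.symm)^[k] K U

/-- The space `Y ∖ {p}`. -/
abbrev Punctured [T1Space Y] (p : Y) : Opens Y := ⟨{p}ᶜ, isOpen_compl_singleton⟩

variable [T2Space Y] {p : Y}

/-- The homeomorphism of `Y ∖ {p}` induced by a homeomorphism of `Y` fixing `p`. -/
def puncturedHomeo (F : Y ≃ₜ Y) (hF : F p = p) : Punctured p ≃ₜ Punctured p :=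
  F.subtype fun x => by
    change x ≠ p ↔ F x ≠ p
    rw [Ne, Ne, ← F.injective.eq_iff (b := p), hF]

theorem puncturedHomeo_coe (F : Y ≃ₜ Y) (hF : F p = p) (x : Punctured p) :
    (puncturedHomeo F hF x : Y) = F x := rfl

theorem puncturedHomeo_symm_pow_coe (F : Y ≃ₜ Y) (hF : F p = p) (k : ℕ) (x : Punctured p) :
    ((((puncturedHomeo F hF)⁻¹ ^ k) x : Punctured p) : Y) = (F.symm)^[k] x := by
  induction k generalizing x with
  | zero => rfl
  | succ k ih =>
    rw [pow_succ, Function.iterate_succ_apply]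
    exact ih ((puncturedHomeo F hF)⁻¹ x)

theorem IsExpandingFrom.disjoint {F : Y ≃ₜ Y} (hF : F p = p) (h : IsExpandingFrom F p)
    {K L : Set (Punctured p)} (hK : IsCompact K) (hL : IsCompact L) :
    ∀ᶠ k : ℕ in atTop, ∀ x ∈ K, ((puncturedHomeo F hF)⁻¹ ^ k) x ∉ L := by
  have hK' := hK.image (continuous_subtype_val)
  have hL' := hL.image (continuous_subtype_val)
  have hU : (Subtype.val '' L)ᶜ ∈ 𝓝 p := by
    refine hL'.isClosed.isOpen_compl.mem_nhds ?_
    rintro ⟨x, -, hx⟩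
    exact x.2 hx
  filter_upwards [h _ hK' _ hU] with k hk x hx hxL
  have := hk ⟨x, hx, rfl⟩
  rw [← puncturedHomeo_symm_pow_coe F hF] at this
  exact this ⟨_, hxL, rfl⟩

theorem IsExpandingFrom.properlyDiscontinuous {F : Y ≃ₜ Y} (hF : F p = p)
    (h : IsExpandingFrom F p) :
    ProperlyDiscontinuousSMul (Subgroup.zpowers (puncturedHomeo F hF)) (Punctured p) where
  finite_disjoint_inter_image {K L} hK hL := by
    set f := puncturedHomeo F hF
    obtain ⟨N, hN⟩ := eventually_atTop.1
      ((h.disjoint hF hK hL).and (h.disjoint hF hL hK))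
    have hfin : ((fun k : ℤ => (⟨f ^ k, k, rfl⟩ : Subgroup.zpowers f)) ''
        (Icc (-(N : ℤ)) N)).Finite := (finite_Icc _ _).image _
    refine hfin.subset ?_
    rintro ⟨_, k, rfl⟩ ⟨_, ⟨x, hx, rfl⟩, hxL⟩
    refine ⟨k, ?_, rfl⟩
    by_contra hk
    have hk' : k < -N ∨ (N : ℤ) < k := by
      simp only [mem_Icc, not_and_or, not_le] at hk; exact hk
    have hxL' : (f ^ k) x ∈ L := hxL
    rcases hk' with hk' | hk'
    · obtain ⟨m, rfl⟩ : ∃ m : ℕ, k = -m := ⟨k.natAbs, by omega⟩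
      refine (hN m (by omega)).1 x hx ?_
      rwa [zpow_neg, zpow_natCast, ← inv_pow] at hxL'
    · obtain ⟨m, rfl⟩ : ∃ m : ℕ, k = m := ⟨k.natAbs, by omega⟩
      refine (hN m (by omega)).2 _ hxL' ?_
      rw [zpow_natCast, inv_pow]
      change ((f ^ m)⁻¹ * (f ^ m)) x ∈ K
      rw [inv_mul_cancel]
      exact hx

theorem IsExpandingFrom.isCancelSMul {F : Y ≃ₜ Y} (hF : F p = p) (h : IsExpandingFrom F p) :
    IsCancelSMul (Subgroup.zpowers (puncturedHomeo F hF)) (Punctured p) := by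
  rw [isCancelSMul_iff_eq_one_of_smul_eq]
  set f := puncturedHomeo F hF with hf
  have key : ∀ (m : ℕ) (x : Punctured p), (f ^ m) x = x → m = 0 := by
    intro m x hx
    by_contra hm
    obtain ⟨N, hN⟩ := eventually_atTop.1
      (h.disjoint hF (isCompact_singleton (x := x)) (isCompact_singleton (x := x)))
    have h1 : ∀ j : ℕ, ((f ^ m)⁻¹ ^ j) x = x := by
      intro j
      induction j with
      | zero => rfl
      | succ j ih =>
        rw [pow_succ]
        change ((f ^ m)⁻¹ ^ j) ((f ^ m)⁻¹ x) = x
        have : (f ^ m)⁻¹ x = x := by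
          nth_rewrite 1 [← hx]
          change ((f ^ m)⁻¹ * (f ^ m)) x = x
          rw [inv_mul_cancel]; rfl
        rw [this, ih]
    refine hN (m * N) (Nat.le_mul_of_pos_left N (Nat.pos_of_ne_zero hm)) x rfl ?_
    rw [pow_mul, inv_pow]
    exact h1 N
  rintro ⟨_, k, rfl⟩ x hx
  have hx' : (f ^ k) x = x := hx
  have hk : k = 0 := by
    rcases Int.natAbs_eq k with hk | hk
    · rw [hk, zpow_natCast] at hx'
      have := key _ _ hx'
      omega
    · rw [hk, zpow_neg, zpow_natCast] at hx'
      have h2 : (f ^ k.natAbs) x = x := by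
        nth_rewrite 1 [← hx']
        change ((f ^ k.natAbs) * (f ^ k.natAbs)⁻¹) x = x
        rw [mul_inv_cancel]; rfl
      have := key _ _ h2
      omega
  subst hk
  rfl

instance (f : Punctured p ≃ₜ Punctured p) :
    ContinuousConstSMul (Subgroup.zpowers f) (Punctured p) where
  continuous_const_smul γ := γ.1.continuous

end Punctured

/-- If a homeomorphism of the model space belongs to a structure groupoid and fixes `p`, then it
induces an automorphism of the complement of `p`. -/
theorem puncturedHomeo_mem_structureAut {Y : Type*} [TopologicalSpace Y] [T2Space Y] {p : Y}
    (𝒢 : StructureGroupoid Y) [ClosedUnderRestriction 𝒢] (F : Y ≃ₜ Y) (hF : F p = p)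
    (h : F.toOpenPartialHomeomorph ∈ 𝒢) :
    puncturedHomeo F hF ∈ structureAut 𝒢 (Punctured p) := by
  intro c hc c' hc'
  have coe : ∀ c ∈ atlas Y (Punctured p), ∀ x, c x = (x : Y) := by
    intro c hc x
    obtain ⟨y, rfl⟩ := Opens.chart_eq ⟨x⟩ hc
    rfl
  set e := c.symm ≫ₕ (puncturedHomeo F hF).toOpenPartialHomeomorph ≫ₕ c' with he
  refine 𝒢.mem_of_eqOnSource (closedUnderRestriction' h e.open_source) ⟨?_, fun y hy => ?_⟩
  · rw [OpenPartialHomeomorph.restr_source' _ _ e.open_source]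
    exact (univ_inter _).symm
  · have hy1 : y ∈ c.target := hy.1
    change c' (puncturedHomeo F hF (c.symm y)) = F y
    rw [coe c' hc', puncturedHomeo_coe, ← coe c hc, c.right_inv hy1]

/-- A quotient of a manifold with a `𝒢`-structure by a free and properly discontinuous group of
automorphisms is a manifold with a `𝒢`-structure. -/
theorem hasGroupoid_quotient {H₀ : Type*} [TopologicalSpace H₀] (𝒢 : StructureGroupoid H₀)
    [ClosedUnderRestriction 𝒢] {M : Type*} [TopologicalSpace M] [T2Space M]
    [LocallyCompactSpace M] [ChartedSpace H₀ M] [HasGroupoid M 𝒢] (Γ : Subgroup (M ≃ₜ M))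
    [ProperlyDiscontinuousSMul Γ M] [ContinuousConstSMul Γ M] [IsCancelSMul Γ M]
    (hΓ : Γ ≤ structureAut 𝒢 M) : HasGroupoid (MulAction.orbitRel.Quotient Γ M) 𝒢 where
  compatible {e e'} he he' := by
    have hπ : IsLocalHomeomorph (Quotient.mk (MulAction.orbitRel Γ M)) :=
      (isQuotientCoveringMap_quotientMk_of_properlyDiscontinuousSMul
        (G := Γ)).isCoveringMap.isLocalHomeomorph
    obtain ⟨x, rfl⟩ : ∃ x : M, e = (hπ.localInverseAt x).trans (chartAt H₀ x) := by
      obtain ⟨q, rfl⟩ := he; exact ⟨_, rfl⟩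
    obtain ⟨x', rfl⟩ : ∃ x : M, e' = (hπ.localInverseAt x).trans (chartAt H₀ x) := by
      obtain ⟨q, rfl⟩ := he'; exact ⟨_, rfl⟩
    set c := chartAt H₀ x
    set c' := chartAt H₀ x'
    set σ := hπ.localInverseAt x with hσ
    set σ' := hπ.localInverseAt x' with hσ'
    set t := (σ.trans c).symm ≫ₕ σ'.trans c' with ht
    have hσs : ∀ a, σ.symm a = Quotient.mk _ a := fun a => congrFun (hπ.localInverseAt_symm x) a
    have hσs' : ∀ a, σ'.symm a = Quotient.mk _ a :=
      fun a => congrFun (hπ.localInverseAt_symm x') a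
    refine 𝒢.locality fun y hy => ?_
    have hyc : y ∈ c.target := hy.1.1
    have hys : Quotient.mk _ (c.symm y) ∈ σ'.source := by
      rw [← hσs]; exact hy.2.1
    obtain ⟨γ, hγ⟩ : ∃ γ : Γ, γ • c.symm y = σ' (Quotient.mk _ (c.symm y)) := by
      have : (Quotient.mk (MulAction.orbitRel Γ M) (σ' (Quotient.mk _ (c.symm y)))) =
          Quotient.mk _ (c.symm y) := by rw [← hσs', σ'.left_inv hys]
      exact Quotient.exact this
    have hmem : c.symm ≫ₕ γ.1.toOpenPartialHomeomorph ≫ₕ c' ∈ 𝒢 :=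
      hΓ γ.2 c (chart_mem_atlas _ _) c' (chart_mem_atlas _ _)
    set s : Set H₀ := t.source ∩ (c.target ∩ c.symm ⁻¹' (γ.1 ⁻¹' σ'.target)) with hs
    have hso : IsOpen s :=
      t.open_source.inter (c.symm.continuousOn.isOpen_inter_preimage c.open_target
        (σ'.open_target.preimage γ.1.continuous))
    have key : ∀ z ∈ s, σ' (Quotient.mk _ (c.symm z)) = γ.1 (c.symm z) := by
      rintro z ⟨-, -, hz⟩
      have : (Quotient.mk (MulAction.orbitRel Γ M) (c.symm z)) =
          Quotient.mk _ (γ.1 (c.symm z)) := Quotient.sound ⟨γ⁻¹, inv_smul_smul γ (c.symm z)⟩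
      rw [this, ← hσs', σ'.right_inv hz]
    have hval : ∀ z ∈ s, t z = c' (γ.1 (c.symm z)) := by
      intro z hz
      rw [← key z hz, ← hσs]
      rfl
    refine ⟨s, hso, ⟨hy, hyc, ?_⟩, ?_⟩
    · change γ • c.symm y ∈ σ'.target
      rw [hγ]
      exact σ'.map_source hys
    · refine 𝒢.mem_of_eqOnSource (closedUnderRestriction' hmem hso) ⟨?_, fun z hz => ?_⟩
      · rw [OpenPartialHomeomorph.restr_source' _ _ hso, OpenPartialHomeomorph.restr_source' _ _ hso]
        ext z
        refine ⟨fun hz => ⟨⟨hz.2.2.1, mem_univ _, ?_⟩, hz.2⟩, fun hz => ⟨hz.2.1, hz.2⟩⟩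
        change γ.1 (c.symm z) ∈ c'.source
        rw [← key z hz.2, ← hσs]
        exact hz.1.2.2
      · rw [OpenPartialHomeomorph.restr_source' _ _ hso] at hz
        exact hval z hz.2
/-! ### The Hopf construction -/

/-- The data of an `n`-dimensional Hopf construction: an expanding automorphism `G` of `ℂⁿ` fixing
the origin, and a diffeomorphism `φ` of `[0, ∞)` that satisfies `φ x > x` for `x > 0` and is
tangent to the identity to infinite order at `0`. -/
structure HopfConstruction (n : ℕ) where
  /-- The expanding automorphism of `ℂⁿ`. -/
  G : EuclideanSpace ℂ (Fin n) ≃ₘ^ω⟮𝓘(ℂ, EuclideanSpace ℂ (Fin n)),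
    𝓘(ℂ, EuclideanSpace ℂ (Fin n))⟯ EuclideanSpace ℂ (Fin n)
  G_zero : G 0 = 0
  G_expanding : IsExpandingFrom G.toHomeomorph 0
  /-- The holonomy diffeomorphism of the half line. -/
  φ : ℝ≥0 ≃ₘ^∞⟮halfLine, halfLine⟯ ℝ≥0
  φ_gt : ∀ x, 0 < x → x < φ x
  φ_flat : ∀ k : ℕ,
    iteratedDerivWithin k (fun t : ℝ => (φ t.toNNReal : ℝ) - t) (Ici 0) 0 = 0

namespace HopfConstruction

variable {n : ℕ} (X : HopfConstruction n)

theorem φ_zero : X.φ 0 = 0 := by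
  have := X.φ_flat 0
  simpa using this

theorem φ_strictMono : StrictMono X.φ := by
  rcases X.φ.continuous.strictMono_of_inj X.φ.injective with h | h
  · exact h
  · exfalso
    have := h (show (0 : ℝ≥0) < 1 from one_pos)
    rw [X.φ_zero] at this
    exact not_lt_zero this

theorem φ_expanding : IsExpandingFrom X.φ.toHomeomorph 0 := by
  intro K hK U hU
  have hsymm : Monotone X.φ.symm := by
    intro a b hab
    rw [← X.φ_strictMono.le_iff_le]
    simpa using hab
  have hle : ∀ x, X.φ.symm x ≤ x := by
    intro x
    rw [← X.φ_strictMono.le_iff_le, X.φ.apply_symm_apply]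
    rcases eq_or_ne x 0 with rfl | hx
    · exact zero_le
    · exact (X.φ_gt x (pos_iff_ne_zero.2 hx)).le
  obtain ⟨M, hM⟩ := hK.bddAbove
  have hanti : Antitone fun k : ℕ => (X.φ.symm)^[k] M := by
    refine antitone_nat_of_succ_le fun k => ?_
    rw [Function.iterate_succ_apply']
    exact hle _
  have hlim := tendsto_atTop_ciInf hanti (OrderBot.bddBelow _)
  set L := ⨅ k : ℕ, (X.φ.symm)^[k] M
  have hL : X.φ.symm L = L := by
    refine tendsto_nhds_unique ?_ ((tendsto_add_atTop_iff_nat 1).2 hlim)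
    simp only [Function.iterate_succ_apply']
    exact (X.φ.symm.continuous.tendsto L).comp hlim
  have hL0 : L = 0 := by
    by_contra h
    have h1 := X.φ_gt L (pos_iff_ne_zero.2 h)
    nth_rewrite 2 [← hL] at h1
    rw [X.φ.apply_symm_apply] at h1
    exact lt_irrefl _ h1
  rw [hL0] at hlim
  obtain ⟨b, hb, hbU⟩ := exists_Ico_subset_of_mem_nhds' hU (show (0 : ℝ≥0) < 1 from one_pos)
  filter_upwards [hlim (Iio_mem_nhds hb.1)] with k hk x hx
  exact hbU ⟨zero_le, lt_of_le_of_lt ((hsymm.iterate k) (hM hx)) hk⟩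

/-- `ℂⁿ × [0, ∞)`. -/
abbrev Model (n : ℕ) : Type := ModelProd (EuclideanSpace ℂ (Fin n)) ℝ≥0

instance : T2Space (Model n) := inferInstanceAs (T2Space (EuclideanSpace ℂ (Fin n) × ℝ≥0))

instance : LocallyCompactSpace (Model n) :=
  inferInstanceAs (LocallyCompactSpace (EuclideanSpace ℂ (Fin n) × ℝ≥0))

/-- The homeomorphism `G × φ` of `ℂⁿ × [0, ∞)`. -/
def GφHomeo : Model n ≃ₜ Model n := X.G.toHomeomorph.prodCongr X.φ.toHomeomorph

theorem GφHomeo_zero : X.GφHomeo (0, 0) = (0, 0) := Prod.ext X.G_zero X.φ_zero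

theorem GφHomeo_expanding : IsExpandingFrom X.GφHomeo (0, 0) := by
  intro K hK U hU
  have hU' : U ∈ 𝓝 (0 : EuclideanSpace ℂ (Fin n)) ×ˢ 𝓝 (0 : ℝ≥0) := by
    rw [← nhds_prod_eq]; exact hU
  obtain ⟨a, ha, b, hb, hab⟩ := Filter.mem_prod_iff.1 hU'
  have it : ∀ (k : ℕ) (p : Model n), (X.GφHomeo.symm)^[k] p =
      ((X.G.toHomeomorph.symm)^[k] p.1, (X.φ.toHomeomorph.symm)^[k] p.2) := by
    intro k
    induction k with
    | zero => intro p; rfl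
    | succ k ih => intro p; rw [Function.iterate_succ_apply, ih]; rfl
  filter_upwards [X.G_expanding _ (hK.image continuous_fst) a ha,
    X.φ_expanding _ (hK.image continuous_snd) b hb] with k h1 h2 p hp
  rw [it]
  exact hab ⟨h1 ⟨p, hp, rfl⟩, h2 ⟨p, hp, rfl⟩⟩

theorem property_prodMap (g : EuclideanSpace ℂ (Fin n) ≃ₘ^ω⟮𝓘(ℂ, EuclideanSpace ℂ (Fin n)),
    𝓘(ℂ, EuclideanSpace ℂ (Fin n))⟯ EuclideanSpace ℂ (Fin n))
    (ψ : ℝ≥0 ≃ₘ^∞⟮halfLine, halfLine⟯ ℝ≥0) :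
    (leafwisePregroupoid (EuclideanSpace ℂ (Fin n))).property (Prod.map g ψ) univ := by
  have hg : ContDiff ℂ ω g := g.contMDiff.contDiff
  refine ⟨?_, fun p _ => ⟨univ, univ_mem, fun q _ q' _ h => congrArg ψ h⟩, fun p _ => ?_⟩
  · have hg' : ContDiff ℝ ∞ g := (hg.restrict_scalars ℝ).of_le le_top
    have hψ : ContDiffOn ℝ ∞ (halfLine ∘ ψ ∘ halfLine.symm) (range halfLine) := by
      have := (contMDiff_iff.1 ψ.contMDiff).2 0 0
      simpa only [mfld_simps, chartAt_self_eq, preimage_univ, inter_univ, univ_inter] using this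
    have h1 : ContDiffOn ℝ ∞ (fun w : EuclideanSpace ℂ (Fin n) × ℝ =>
        (g w.1, (halfLine ∘ ψ ∘ halfLine.symm) w.2)) (univ ×ˢ range halfLine) :=
      (hg'.comp_contDiffOn contDiffOn_fst).prodMk
        (hψ.comp contDiffOn_snd fun w hw => hw.2)
    refine ContDiffOn.mono (s := univ ×ˢ range halfLine) h1 ?_
    rintro w ⟨-, ⟨p, rfl⟩⟩
    exact ⟨mem_univ _, mem_range_self _⟩
  · exact (hg.differentiable (by simp)).differentiableAt

theorem GφHomeo_mem : X.GφHomeo.toOpenPartialHomeomorph ∈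
    leafwiseGroupoid (EuclideanSpace ℂ (Fin n)) :=
  ⟨property_prodMap X.G X.φ, property_prodMap X.G.symm X.φ.symm⟩

theorem G_mem : X.G.toHomeomorph.toOpenPartialHomeomorph ∈
    contDiffGroupoid ω 𝓘(ℂ, EuclideanSpace ℂ (Fin n)) := by
  constructor
  · exact (X.G.contMDiff.contDiff).contDiffOn
  · exact (X.G.symm.contMDiff.contDiff).contDiffOn

/-- `ℂⁿ × [0, ∞) ∖ {(0, 0)}`. -/
abbrev CoverR (n : ℕ) : Opens (Model n) := Punctured ((0, 0) : Model n)

/-- `ℂⁿ ∖ {0}`. -/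
abbrev CoverH (n : ℕ) : Opens (EuclideanSpace ℂ (Fin n)) :=
  Punctured (0 : EuclideanSpace ℂ (Fin n))

/-- The homeomorphism `T = G × φ` of `ℂⁿ × [0, ∞) ∖ {(0, 0)}`. -/
def T : CoverR n ≃ₜ CoverR n := puncturedHomeo X.GφHomeo X.GφHomeo_zero

/-- The restriction of `G` to `ℂⁿ ∖ {0}`. -/
def G₀ : CoverH n ≃ₜ CoverH n := puncturedHomeo X.G.toHomeomorph X.G_zero

instance : ProperlyDiscontinuousSMul (Subgroup.zpowers X.T) (CoverR n) :=
  X.GφHomeo_expanding.properlyDiscontinuous _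

instance : IsCancelSMul (Subgroup.zpowers X.T) (CoverR n) :=
  X.GφHomeo_expanding.isCancelSMul _

instance : ProperlyDiscontinuousSMul (Subgroup.zpowers X.G₀) (CoverH n) :=
  X.G_expanding.properlyDiscontinuous _

instance : IsCancelSMul (Subgroup.zpowers X.G₀) (CoverH n) :=
  X.G_expanding.isCancelSMul _

instance : LocallyCompactSpace (CoverR n) := (CoverR n).isOpen.locallyCompactSpace

instance : LocallyCompactSpace (CoverH n) := (CoverH n).isOpen.locallyCompactSpace

/-- The Reeb component `R = (ℂⁿ × [0, ∞) ∖ {(0, 0)}) / T^ℤ`, with the quotient topology and the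
charts given by the local inverses of the quotient map. -/
abbrev R : Type := MulAction.orbitRel.Quotient (Subgroup.zpowers X.T) (CoverR n)

/-- The boundary Hopf manifold `H = (ℂⁿ ∖ {0}) / G^ℤ`, with the quotient topology and the charts
given by the local inverses of the quotient map. -/
abbrev H : Type := MulAction.orbitRel.Quotient (Subgroup.zpowers X.G₀) (CoverH n)

instance : HasGroupoid X.R (leafwiseGroupoid (EuclideanSpace ℂ (Fin n))) :=
  hasGroupoid_quotient _ _ <| by
    rw [Subgroup.zpowers_le]
    exact puncturedHomeo_mem_structureAut _ _ _ X.GφHomeo_mem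

instance : IsManifold 𝓘(ℂ, EuclideanSpace ℂ (Fin n)) ω X.H where
  toHasGroupoid := hasGroupoid_quotient _ _ <| by
    rw [Subgroup.zpowers_le]
    exact puncturedHomeo_mem_structureAut _ _ _ X.G_mem

/-- The group of leafwise holomorphic smooth automorphisms of the Reeb component. -/
def AutR : Subgroup (X.R ≃ₜ X.R) := leafwiseAut (EuclideanSpace ℂ (Fin n)) X.R

/-- The group of holomorphic automorphisms of the boundary Hopf manifold. -/
def AutH : Subgroup (X.H ≃ₜ X.H) := holomorphicAut (EuclideanSpace ℂ (Fin n)) X.H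

/-- The inclusion `z ↦ (z, 0)` of `ℂⁿ ∖ {0}` as the boundary of `ℂⁿ × [0, ∞) ∖ {(0, 0)}`. -/
def coverBoundary (z : CoverH n) : CoverR n :=
  ⟨((z : EuclideanSpace ℂ (Fin n)), (0 : ℝ≥0)), fun h => z.2 (congrArg Prod.fst h)⟩

theorem coverBoundary_G₀ (z : CoverH n) : coverBoundary (X.G₀ z) = X.T (coverBoundary z) :=
  Subtype.ext (Prod.ext rfl X.φ_zero.symm)

theorem coverBoundary_zpow (k : ℤ) (z : CoverH n) :
    coverBoundary ((X.G₀ ^ k) z) = (X.T ^ k) (coverBoundary z) := by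
  induction k generalizing z with
  | zero => rfl
  | succ k ih =>
    rw [zpow_add_one, zpow_add_one]
    change coverBoundary ((X.G₀ ^ (k : ℤ)) (X.G₀ z)) = (X.T ^ (k : ℤ)) (X.T (coverBoundary z))
    rw [ih, coverBoundary_G₀]
  | pred k ih =>
    rw [zpow_sub_one, zpow_sub_one]
    change coverBoundary ((X.G₀ ^ (-k : ℤ)) (X.G₀.symm z)) =
      (X.T ^ (-k : ℤ)) (X.T.symm (coverBoundary z))
    rw [ih]
    congr 1
    rw [Homeomorph.eq_symm_apply, ← coverBoundary_G₀, Homeomorph.apply_symm_apply]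

/-- The inclusion of the Hopf manifold `H` in `R` as the boundary, induced by `z ↦ (z, 0)`. -/
def boundary : X.H → X.R :=
  Quotient.map coverBoundary <| by
    rintro _ z ⟨⟨_, k, rfl⟩, rfl⟩
    exact ⟨⟨X.T ^ k, k, rfl⟩, (X.coverBoundary_zpow k z).symm⟩

/-- The boundary inclusion is injective, so that an automorphism of `R` has at most one
restriction to `H`. -/
theorem boundary_injective : Function.Injective X.boundary := by
  intro a b
  induction a using Quotient.inductionOn with
  | h z =>
    induction b using Quotient.inductionOn with
    | h w =>
      intro h
      obtain ⟨⟨_, k, rfl⟩, hk⟩ := Quotient.exact h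
      refine Quotient.sound ⟨⟨X.G₀ ^ k, k, rfl⟩, ?_⟩
      have h1 : coverBoundary ((X.G₀ ^ k) w) = coverBoundary z := by
        rw [coverBoundary_zpow]; exact hk
      exact Subtype.ext (congrArg (fun q : CoverR n => (q : Model n).1) h1)

end HopfConstruction

end

/-! Restriction. In charts an automorphism of `R` has the form (z, x) ↦ (w(z, x), y(x)). It keeps
the boundary: were a point with x = 0 sent to one with y > 0, the transverse part of the inverse
would be a continuous injective function near y, nonnegative and vanishing at y, which strict
monotonicity excludes (`snd_eq_zero_of_mem_leafwiseGroupoid`). On x = 0 the component w is complex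
differentiable in z, hence analytic by Osgood's lemma. The same applies to the inverse, and
injectivity of `boundary` makes restriction a homomorphism.

Surjectivity. Since n ≥ 2, maps from ℂⁿ∖{O} lift through coverings, so an automorphism g of `H`
lifts to a biholomorphic Φ (`exists_lift_aut`). By Hartogs, Φ extends to an automorphism F of ℂⁿ
fixing O (`exists_diffeomorph_extension`). Being a lift, F conjugates G to some power G^k, and the
same argument for g⁻¹ forces k = ±1. If k = -1, then F(G^{-m} z) = G^m(F z); the left side tends to
F(O) = O, which an expanding G forbids on the right. So F commutes with G (`commute_of_lift`), F ×
id commutes with T, and the map it induces on `R` restricts to g.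

Osgood's lemma follows from Cauchy estimates on complex lines; Hartogs' theorem for a point follows
from averaging over circles in one direction. -/

noncomputable section

/-! ### Cauchy estimates and holomorphy of the derivative -/

section SeveralComplexVariables

open Complex Metric MeasureTheory

variable {E F : Type*} [NormedAddCommGroup E] [NormedSpace ℂ E]
  [NormedAddCommGroup F] [NormedSpace ℂ F]

/-- This is the one-variable Cauchy estimate for t ↦ f (x + t v) on the disc of radius r / ‖v‖. -/
theorem Complex.norm_fderiv_le_of_forall_mem_ball {f : E → F} {x : E} {r M : ℝ} (hr : 0 < r)
    (hf : DifferentiableOn ℂ f (ball x r)) (hM : ∀ y ∈ ball x r, ‖f y‖ ≤ M) :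
    ‖fderiv ℂ f x‖ ≤ M / r := by
  have hM0 : 0 ≤ M := (norm_nonneg _).trans (hM x (mem_ball_self hr))
  refine ContinuousLinearMap.opNorm_le_bound _ (by positivity) fun v => ?_
  rcases eq_or_ne v 0 with rfl | hv
  · simp
  have hv' : 0 < ‖v‖ := norm_pos_iff.2 hv
  have hline : MapsTo (fun t : ℂ => x + t • v) (ball 0 (r / ‖v‖)) (ball x r) := by
    intro t ht
    rw [mem_ball_zero_iff, lt_div_iff₀ hv'] at ht
    simpa [norm_smul] using ht
  have hd : DifferentiableOn ℂ (fun t : ℂ => f (x + t • v)) (ball 0 (r / ‖v‖)) :=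
    hf.comp (by fun_prop) hline
  have hx : HasFDerivAt f (fderiv ℂ f x) (x + (0 : ℂ) • v) := by
    simpa using (hf.differentiableAt (ball_mem_nhds x hr)).hasFDerivAt
  have hderiv : deriv (fun t : ℂ => f (x + t • v)) 0 = fderiv ℂ f x v := by
    have h2 : HasDerivAt (fun t : ℂ => x + t • v) v 0 := by
      simpa using ((hasDerivAt_id (0 : ℂ)).smul_const v).const_add x
    exact (hx.comp_hasDerivAt (0 : ℂ) h2).deriv
  rw [← hderiv]
  have key : ∀ ρ ∈ Ioo 0 (r / ‖v‖), ‖deriv (fun t : ℂ => f (x + t • v)) 0‖ ≤ M / ρ := by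
    intro ρ hρ
    refine norm_deriv_le_of_forall_mem_sphere_norm_le hρ.1 ?_ fun t ht => hM _ (hline ?_)
    · exact (hd.mono (closedBall_subset_ball hρ.2)).diffContOnCl_ball subset_rfl
    · exact closedBall_subset_ball hρ.2 (sphere_subset_closedBall ht)
  have hpos : 0 < r / ‖v‖ := by positivity
  -- The one-variable estimate needs circles inside the open disc, so the full radius is reached
  -- only in the limit.
  have hlim : Tendsto (fun ρ => M / ρ) (𝓝[<] (r / ‖v‖)) (𝓝 (M / (r / ‖v‖))) :=
    (tendsto_const_nhds.div tendsto_id hpos.ne').mono_left nhdsWithin_le_nhds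
  have := ge_of_tendsto hlim (by
    filter_upwards [Ioo_mem_nhdsLT hpos] with ρ hρ using key ρ hρ)
  rwa [div_div_eq_mul_div, mul_div_right_comm] at this

variable [FiniteDimensional ℂ E] [FiniteDimensional ℂ F]

/-- Differentiation of a holomorphic function under the integral sign, along a curve of
translations. -/
theorem DifferentiableOn.differentiableAt_intervalIntegral {f : E → F} {U : Set E} (hU : IsOpen U)
    (hf : DifferentiableOn ℂ f U) {k : ℝ → ℂ} (hk : Continuous k) {c : ℝ → E} (hc : Continuous c)
    {a b : ℝ} {x₀ : E} (hx₀ : ∀ θ ∈ uIcc a b, x₀ + c θ ∈ U) :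
    DifferentiableAt ℂ (fun x => ∫ θ in a..b, k θ • f (x + c θ)) x₀ := by
  have : ProperSpace E := FiniteDimensional.proper ℂ E
  have : CompleteSpace F := FiniteDimensional.complete ℂ F
  have : CompleteSpace (E →L[ℂ] F) := FiniteDimensional.complete ℂ _
  have : ProperSpace (E →L[ℂ] F) := FiniteDimensional.proper ℂ _
  have hfc := hf.continuousOn
  set K : Set E := (fun θ => x₀ + c θ) '' uIcc a b with hKdef
  have hK : IsCompact K := isCompact_uIcc.image (by fun_prop)
  -- Half of the margin δ is spent on moving x₀, the other half on a Cauchy estimate at each x + c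
  -- θ; this gives the dominating constant A * (M / (δ / 2)).
  obtain ⟨δ, hδ, hδU⟩ := hK.exists_cthickening_subset_open hU (by rintro _ ⟨θ, hθ, rfl⟩; exact hx₀ θ hθ)
  obtain ⟨M, hM⟩ := (hK.cthickening (r := δ)).exists_bound_of_continuousOn (hfc.mono hδU)
  obtain ⟨A, hA⟩ := (isCompact_uIcc (a := a) (b := b)).exists_bound_of_continuousOn hk.continuousOn
  have hsub : ∀ θ ∈ uIcc a b, ∀ x ∈ ball x₀ (δ / 2), ball (x + c θ) (δ / 2) ⊆ cthickening δ K := by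
    intro θ hθ x hx y hy
    refine mem_cthickening_of_dist_le y (x₀ + c θ) δ K ⟨θ, hθ, rfl⟩ ?_
    have h1 := dist_triangle y (x + c θ) (x₀ + c θ)
    rw [dist_add_right] at h1
    rw [mem_ball] at hx hy
    linarith
  have hmem : ∀ θ ∈ uIcc a b, ∀ x ∈ ball x₀ (δ / 2), x + c θ ∈ U := fun θ hθ x hx =>
    hδU (hsub θ hθ x hx (mem_ball_self (by positivity)))
  have hcont : ∀ x ∈ ball x₀ (δ / 2), ContinuousOn (fun θ => k θ • f (x + c θ)) (uIcc a b) :=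
    fun x hx => hk.continuousOn.smul (hfc.comp (by fun_prop) fun θ hθ => hmem θ hθ x hx)
  borelize E
  borelize (E →L[ℂ] F)
  have h := intervalIntegral.hasFDerivAt_integral_of_dominated_of_fderiv_le (𝕜 := ℂ) (μ := volume)
    (F := fun x θ => k θ • f (x + c θ)) (F' := fun x θ => k θ • fderiv ℂ f (x + c θ))
    (a := a) (b := b) (s := ball x₀ (δ / 2)) (bound := fun _ => A * (M / (δ / 2))) (x₀ := x₀)
    (ball_mem_nhds _ (by positivity)) ?_ ?_ ?_ ?_ ?_ ?_
  · exact h.differentiableAt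
  · filter_upwards [ball_mem_nhds x₀ (half_pos hδ)] with x hx
    exact ((hcont x hx).mono uIoc_subset_uIcc).aestronglyMeasurable measurableSet_uIoc
  · exact (hcont x₀ (mem_ball_self (by positivity))).intervalIntegrable
  · refine Measurable.aestronglyMeasurable ?_
    exact hk.measurable.smul ((measurable_fderiv ℂ f).comp (by fun_prop : Continuous _).measurable)
  · refine Eventually.of_forall fun θ hθ x hx => ?_
    have hθ' := uIoc_subset_uIcc hθ
    rw [norm_smul]
    have hA0 := hA θ hθ'
    refine mul_le_mul hA0 ?_ (norm_nonneg _) ((norm_nonneg _).trans hA0)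
    exact norm_fderiv_le_of_forall_mem_ball (by positivity)
      (hf.mono ((hsub θ hθ' x hx).trans hδU)) fun y hy => hM y (hsub θ hθ' x hx hy)
  · exact intervalIntegrable_const
  · refine Eventually.of_forall fun θ hθ x hx => ?_
    have h1 : HasFDerivAt f (fderiv ℂ f (x + c θ)) (x + c θ) :=
      (hf.differentiableAt (hU.mem_nhds (hmem θ (uIoc_subset_uIcc hθ) x hx))).hasFDerivAt
    exact ((hasFDerivAt_comp_add_right (c θ)).2 h1).const_smul (k θ)

/-- Each directional derivative is a Cauchy integral of f over a circle in that direction, and such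
an integral can be differentiated in its centre. Finitely many directions determine the derivative.
-/
theorem DifferentiableOn.fderiv_of_isOpen {f : E → F} {U : Set E} (hU : IsOpen U)
    (hf : DifferentiableOn ℂ f U) : DifferentiableOn ℂ (fderiv ℂ f) U := by
  have : CompleteSpace F := FiniteDimensional.complete ℂ F
  intro x hx
  refine DifferentiableAt.differentiableWithinAt ?_
  suffices h : ∀ v : E, DifferentiableAt ℂ (fun y => fderiv ℂ f y v) x by
    set b := Module.finBasis ℂ E
    -- `B` rebuilds a linear map from its values on the basis `b`.
    set B : (Fin (Module.finrank ℂ E) → F) →L[ℂ] (E →L[ℂ] F) :=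
      ∑ i, (ContinuousLinearMap.smulRightL ℂ E F (LinearMap.toContinuousLinearMap (b.coord i))) ∘L
        (ContinuousLinearMap.proj i)
    have hB : fderiv ℂ f = fun y => B fun i => fderiv ℂ f y (b i) := by
      ext y v
      conv_lhs => rw [← b.sum_repr v, map_sum]
      simp [B]
    rw [hB]
    exact B.differentiableAt.comp x (differentiableAt_pi.2 fun i => h (b i))
  intro v
  obtain ⟨r, hr, hrU⟩ := Metric.isOpen_iff.1 hU x hx
  obtain ⟨ρ, hρ, hρv⟩ : ∃ ρ : ℝ, 0 < ρ ∧ ρ * ‖v‖ < r / 2 := by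
    refine ⟨r / (2 * (‖v‖ + 1)), by positivity, ?_⟩
    rw [div_mul_eq_mul_div, div_lt_div_iff₀ (by positivity) (by positivity)]
    nlinarith [norm_nonneg v]
  have hmem : ∀ y ∈ ball x (r / 2), ∀ t ∈ closedBall (0 : ℂ) ρ, y + t • v ∈ U := by
    intro y hy t ht
    apply hrU
    rw [mem_closedBall_zero_iff] at ht
    rw [mem_ball_iff_norm] at hy ⊢
    have h1 : ‖y + t • v - x‖ ≤ ‖y - x‖ + ‖t‖ * ‖v‖ := by
      rw [← norm_smul, add_sub_right_comm]; exact norm_add_le _ _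
    nlinarith [norm_nonneg v]
  have hform : (fun y => fderiv ℂ f y v) =ᶠ[𝓝 x] fun y =>
      (2 * Real.pi * I : ℂ)⁻¹ • ∫ θ in (0 : ℝ)..2 * Real.pi,
        (_root_.deriv (circleMap 0 ρ) θ * (circleMap 0 ρ θ ^ 2)⁻¹) • f (y + circleMap 0 ρ θ • v) := by
    filter_upwards [ball_mem_nhds x (half_pos hr)] with y hy
    have hy' : HasFDerivAt f (fderiv ℂ f y) (y + (0 : ℂ) • v) := by
      have : y ∈ U := by simpa using hmem y hy 0 (mem_closedBall_self hρ.le)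
      simpa using (hf.differentiableAt (hU.mem_nhds this)).hasFDerivAt
    have hderiv : _root_.deriv (fun t : ℂ => f (y + t • v)) 0 = fderiv ℂ f y v := by
      have h2 : HasDerivAt (fun t : ℂ => y + t • v) v 0 := by
        simpa using ((hasDerivAt_id (0 : ℂ)).smul_const v).const_add y
      exact (hy'.comp_hasDerivAt (0 : ℂ) h2).deriv
    rw [← hderiv]
    have hd : DifferentiableOn ℂ (fun t : ℂ => f (y + t • v)) (closedBall 0 ρ) :=
      hf.comp (by fun_prop) (hmem y hy)
    have h3 := hd.deriv_eq_smul_circleIntegral hρ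
    rw [circleIntegral] at h3
    rw [eq_inv_smul_iff₀ two_pi_I_ne_zero, ← h3]
    simp [mul_smul]
  refine DifferentiableAt.congr_of_eventuallyEq ?_ hform
  refine DifferentiableAt.const_smul (hf.differentiableAt_intervalIntegral hU ?_ ?_ ?_) _
  · have h0 : ∀ θ, circleMap 0 ρ θ ^ 2 ≠ 0 := fun θ =>
      pow_ne_zero _ (circleMap_ne_center hρ.ne')
    simp only [deriv_circleMap]
    exact ((continuous_circleMap 0 ρ).mul continuous_const).mul
      (((continuous_circleMap 0 ρ).pow 2).inv₀ h0)
  · exact (continuous_circleMap 0 ρ).smul continuous_const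
  · intro θ _
    exact hmem x (mem_ball_self (half_pos hr)) _ (circleMap_mem_closedBall 0 hρ.le θ)

end SeveralComplexVariables

/-! ### Osgood's lemma and Hartogs extension across a point -/

section SeveralComplexVariables

open Complex Metric MeasureTheory

/-- The induction passes from f to its derivative, so the target must vary; a common universe keeps
`E →L[ℂ] F` in range. -/
theorem DifferentiableOn.contDiffOn_nat_of_isOpen.{u} {E : Type u} [NormedAddCommGroup E]
    [NormedSpace ℂ E] [FiniteDimensional ℂ E] (k : ℕ) :
    ∀ {F : Type u} [NormedAddCommGroup F] [NormedSpace ℂ F] [FiniteDimensional ℂ F]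
      {f : E → F} {U : Set E}, IsOpen U → DifferentiableOn ℂ f U → ContDiffOn ℂ k f U := by
  induction k with
  | zero => intro F _ _ _ f U _ hf; exact contDiffOn_zero.2 hf.continuousOn
  | succ k ih =>
    intro F _ _ _ f U hU hf
    rw [Nat.cast_add, Nat.cast_one, contDiffOn_succ_iff_fderiv_of_isOpen hU]
    exact ⟨hf, fun h => by simp at h, ih hU (hf.fderiv_of_isOpen hU)⟩

/-- Each differentiation costs ρ in radius and a factor 1 / ρ in the bound. -/
theorem Complex.norm_iteratedFDeriv_le_of_forall_mem_ball.{u} {E : Type u} [NormedAddCommGroup E]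
    [NormedSpace ℂ E] [FiniteDimensional ℂ E] {ρ : ℝ} (hρ : 0 < ρ) (k : ℕ) :
    ∀ {F : Type u} [NormedAddCommGroup F] [NormedSpace ℂ F] [FiniteDimensional ℂ F]
      {f : E → F} {x : E} {r M : ℝ}, 0 < r → k * ρ ≤ r → DifferentiableOn ℂ f (ball x r) →
      (∀ y ∈ ball x r, ‖f y‖ ≤ M) → ‖iteratedFDeriv ℂ k f x‖ ≤ M / ρ ^ k := by
  induction k with
  | zero =>
    intro F _ _ _ f x r M hr _ _ hM
    simpa using hM x (mem_ball_self hr)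
  | succ k ih =>
    intro F _ _ _ f x r M hr hk hf hM
    rw [← norm_iteratedFDeriv_fderiv]
    rw [Nat.cast_succ, add_one_mul] at hk
    have hM0 : 0 ≤ M := (norm_nonneg _).trans (hM x (mem_ball_self hr))
    -- For k = 0 the inner ball of radius k * ρ used below would be empty.
    rcases Nat.eq_zero_or_pos k with rfl | hkpos
    · rw [norm_iteratedFDeriv_zero]
      refine (norm_fderiv_le_of_forall_mem_ball hr hf hM).trans ?_
      rw [zero_add, pow_one]
      gcongr
      simpa using hk
    have hkρ : 0 < k * ρ := by positivity
    have hsub : ∀ y ∈ ball x (k * ρ), ball y ρ ⊆ ball x r := fun y hy =>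
      ball_subset_ball' (by rw [mem_ball] at hy; linarith)
    have h1 : ∀ y ∈ ball x (k * ρ), ‖fderiv ℂ f y‖ ≤ M / ρ := fun y hy =>
      norm_fderiv_le_of_forall_mem_ball hρ (hf.mono (hsub y hy)) fun z hz => hM z (hsub y hy hz)
    have h2 := ih hkρ le_rfl
      ((hf.fderiv_of_isOpen isOpen_ball).mono (ball_subset_ball (by linarith))) h1
    rwa [div_div, ← pow_succ'] at h2

universe u

variable {E F : Type u} [NormedAddCommGroup E] [NormedSpace ℂ E] [FiniteDimensional ℂ E]
  [NormedAddCommGroup F] [NormedSpace ℂ F] [FiniteDimensional ℂ F]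

theorem DifferentiableOn.iteratedDeriv_comp_line {f : E → F} {U : Set E} (hU : IsOpen U)
    (hf : DifferentiableOn ℂ f U) (x v : E) (k : ℕ) :
    ∀ t : ℂ, x + t • v ∈ U →
      iteratedDeriv k (fun t : ℂ => f (x + t • v)) t =
        iteratedFDeriv ℂ k f (x + t • v) (fun _ => v) := by
  have hline : ∀ t : ℂ, HasDerivAt (fun t : ℂ => x + t • v) v t := fun t => by
    simpa using ((hasDerivAt_id t).smul_const v).const_add x
  induction k with
  | zero => intro t _; simp
  | succ k ih =>
    intro t ht
    have hev : ∀ᶠ s in 𝓝 t, x + s • v ∈ U := (hline t).continuousAt (hU.mem_nhds ht)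
    have h1 : iteratedDeriv k (fun t : ℂ => f (x + t • v)) =ᶠ[𝓝 t]
        fun s => iteratedFDeriv ℂ k f (x + s • v) (fun _ => v) := by
      filter_upwards [hev] with s hs using ih s hs
    rw [iteratedDeriv_succ, h1.deriv_eq, iteratedFDeriv_succ_apply_left]
    have h2 : DifferentiableAt ℂ (iteratedFDeriv ℂ k f) (x + t • v) :=
      ((hf.contDiffOn_nat_of_isOpen (k + 1) hU).contDiffAt (hU.mem_nhds ht)).differentiableAt_iteratedFDeriv
        (by exact_mod_cast Nat.lt_succ_self k)
    have h3 := h2.hasFDerivAt.comp_hasDerivAt t (hline t)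
    have h4 := (ContinuousMultilinearMap.apply ℂ (fun _ : Fin k => E) F
      (fun _ => v)).hasFDerivAt.comp_hasDerivAt t h3
    exact h4.deriv

/-- The one-variable Taylor series of t ↦ f (x + t y) converges on the disc of radius r / ‖y‖ > 1;
evaluate it at t = 1. -/
theorem DifferentiableOn.hasSum_iteratedFDeriv {f : E → F} {x : E} {r : ℝ}
    (hf : DifferentiableOn ℂ f (ball x r)) {y : E} (hy : ‖y‖ < r) :
    HasSum (fun k : ℕ => (k.factorial : ℂ)⁻¹ • iteratedFDeriv ℂ k f x (fun _ => y))
      (f (x + y)) := by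
  have : CompleteSpace F := FiniteDimensional.complete ℂ F
  rcases eq_or_ne y 0 with rfl | hy0
  · have h0 : (0 : ℝ) < r := by simpa using hy
    convert hasSum_single (f := fun k : ℕ => (k.factorial : ℂ)⁻¹ •
      iteratedFDeriv ℂ k f x (fun _ => (0 : E))) 0 ?_ using 1
    · simp
    · intro k hk
      have : Nonempty (Fin k) := ⟨⟨0, Nat.pos_of_ne_zero hk⟩⟩
      rw [show (fun _ : Fin k => (0 : E)) = 0 from rfl, ContinuousMultilinearMap.map_zero,
        smul_zero]
  have hy' : 0 < ‖y‖ := norm_pos_iff.2 hy0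
  have hline : MapsTo (fun t : ℂ => x + t • y) (ball 0 (r / ‖y‖)) (ball x r) := by
    intro t ht
    rw [mem_ball_zero_iff, lt_div_iff₀ hy'] at ht
    simpa [norm_smul] using ht
  have hd : DifferentiableOn ℂ (fun t : ℂ => f (x + t • y)) (ball 0 (r / ‖y‖)) :=
    hf.comp (by fun_prop) hline
  have h1 : (1 : ℂ) ∈ ball 0 (r / ‖y‖) := by
    rw [mem_ball_zero_iff, norm_one, lt_div_iff₀ hy']; simpa using hy
  have hr : 0 < r := hy'.trans hy
  have h := hasSum_taylorSeries_on_ball hd h1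
  convert h using 2 with k
  · rw [hf.iteratedDeriv_comp_line isOpen_ball x y k 0 (by simpa using hr)]
    simp
  · simp

/-- **Osgood's lemma** for holomorphic maps: on an open subset of a finite-dimensional complex
vector space, complex differentiable maps are analytic. -/
theorem DifferentiableOn.analyticOnNhd_of_finiteDimensional {f : E → F} {U : Set E}
    (hU : IsOpen U) (hf : DifferentiableOn ℂ f U) : AnalyticOnNhd ℂ f U := by
  intro x hx
  have hc : ContinuousAt f x := hf.continuousOn.continuousAt (hU.mem_nhds hx)
  obtain ⟨r, hr, hrU⟩ := Metric.mem_nhds_iff.1 (inter_mem (hU.mem_nhds hx)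
    (hc.norm.eventually_lt continuousAt_const (lt_add_one ‖f x‖)))
  have hd : DifferentiableOn ℂ f (ball x r) := hf.mono fun y hy => (hrU hy).1
  set M := ‖f x‖ + 1
  have hM0 : 0 ≤ M := by positivity
  have hM : ∀ y ∈ ball x r, ‖f y‖ ≤ M := fun y hy => (hrU hy).2.le
  set p : FormalMultilinearSeries ℂ E F := fun k =>
    (k.factorial : ℂ)⁻¹ • iteratedFDeriv ℂ k f x with hp
  -- The Cauchy estimate with ρ = r / k bounds the k-th coefficient by M k^k / (k! r^k) ≤ M (e /
  -- r)^k, whence the radius r / e.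
  obtain ⟨R, hR⟩ : ∃ R : ℝ≥0, (R : ℝ) = r * Real.exp (-1) :=
    ⟨⟨r * Real.exp (-1), by positivity⟩, rfl⟩
  have hbound : ∀ k, ‖p k‖ * (R : ℝ) ^ k ≤ M := by
    intro k
    rcases Nat.eq_zero_or_pos k with rfl | hk
    · simpa [hp] using hM x (mem_ball_self hr)
    have hk' : (0 : ℝ) < k := by exact_mod_cast hk
    have h1 := norm_iteratedFDeriv_le_of_forall_mem_ball (ρ := r / k) (by positivity) k hr
      (mul_div_cancel₀ r hk'.ne').le hd hM
    have h2 := Real.pow_div_factorial_le_exp (k : ℝ) hk'.le k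
    have h3 : ‖p k‖ ≤ (k.factorial : ℝ)⁻¹ * (M / (r / k) ^ k) := by
      rw [hp, norm_smul, norm_inv, Complex.norm_natCast]
      gcongr
    have hRk : (R : ℝ) ^ k = r ^ k * Real.exp (-k) := by
      rw [hR, mul_pow, ← Real.exp_nat_mul]
      ring_nf
    calc ‖p k‖ * (R : ℝ) ^ k ≤ (k.factorial : ℝ)⁻¹ * (M / (r / k) ^ k) * (R : ℝ) ^ k := by gcongr
      _ = M * ((k : ℝ) ^ k / k.factorial) * Real.exp (-k) := by
        rw [hRk, div_pow]; field_simp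
      _ ≤ M * Real.exp k * Real.exp (-k) := by gcongr
      _ = M := by rw [mul_assoc, ← Real.exp_add, add_neg_cancel, Real.exp_zero, mul_one]
  have hRpos : (0 : ℝ) < R := by rw [hR]; exact mul_pos hr (Real.exp_pos _)
  have hRr : (R : ℝ) ≤ r := by
    rw [hR]
    exact mul_le_of_le_one_right hr.le (Real.exp_le_one_iff.2 (by norm_num))
  refine ⟨p, R, p.le_radius_of_bound M hbound, by exact_mod_cast hRpos, ?_⟩
  intro y hy
  rw [Metric.eball_coe, mem_ball_zero_iff] at hy
  simpa [hp] using hd.hasSum_iteratedFDeriv (hy.trans_le hRr)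

/-- **Hartogs' theorem** for an isolated point: a map which is holomorphic off a point of a complex
vector space of dimension at least two extends holomorphically through this point. -/
theorem DifferentiableOn.exists_differentiable_extension (hE : 2 ≤ Module.finrank ℂ E)
    {f : E → F} (hf : DifferentiableOn ℂ f {0}ᶜ) :
    ∃ g : E → F, Differentiable ℂ g ∧ EqOn g f {0}ᶜ := by
  have : CompleteSpace F := FiniteDimensional.complete ℂ F
  have : Nontrivial E := Module.nontrivial_of_finrank_pos (R := ℂ) (by omega)
  obtain ⟨e, he⟩ := exists_ne (0 : E)
  have he' : 0 < ‖e‖ := norm_pos_iff.2 he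
  have hne : ∀ x ∈ ball (0 : E) ‖e‖, ∀ θ : ℝ, x + circleMap 0 1 θ • e ∈ ({0}ᶜ : Set E) := by
    intro x hx θ h
    rw [mem_ball_zero_iff] at hx
    have h1 : x = -(circleMap 0 1 θ • e) := eq_neg_of_add_eq_zero_left h
    rw [h1, norm_neg, norm_smul, norm_circleMap_zero, abs_one, one_mul] at hx
    exact lt_irrefl _ hx
  -- Mean of f over the circle x + S¹e, which misses 0 when ‖x‖ < ‖e‖. The factor `(1 : ℂ)` fits the
  -- kernel of `differentiableAt_intervalIntegral`.
  set h : E → F := fun x => (2 * Real.pi : ℝ)⁻¹ • ∫ θ in (0 : ℝ)..2 * Real.pi,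
    (1 : ℂ) • f (x + circleMap 0 1 θ • e) with hh
  have hhd : DifferentiableOn ℂ h (ball 0 ‖e‖) := fun x hx =>
    ((hf.differentiableAt_intervalIntegral isOpen_compl_singleton continuous_const
      ((continuous_circleMap 0 1).smul continuous_const)
      fun θ _ => hne x hx θ).const_smul _).differentiableWithinAt
  -- Off the line ℂe the whole complex line x + ℂe avoids 0, so f is entire along it and the mean
  -- value property applies.
  have hline : ∀ x ∉ (ℂ ∙ e : Submodule ℂ E), h x = f x := by
    intro x hx
    have hmem : ∀ t : ℂ, x + t • e ∈ ({0}ᶜ : Set E) := by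
      intro t ht
      refine hx (Submodule.mem_span_singleton.2 ⟨-t, ?_⟩)
      rw [neg_smul]
      exact (eq_neg_of_add_eq_zero_left ht).symm
    have hd : Differentiable ℂ fun t : ℂ => f (x + t • e) := fun t =>
      (hf.differentiableAt (isOpen_compl_singleton.mem_nhds (hmem t))).comp t (by fun_prop)
    have := hd.diffContOnCl.circleAverage (c := 0) (R := 1)
    simpa [Real.circleAverage, hh] using this
  have hdense : Dense ((ℂ ∙ e : Submodule ℂ E) : Set E)ᶜ := by
    rw [← interior_eq_empty_iff_dense_compl]
    by_contra hint
    have htop := Submodule.eq_top_of_nonempty_interior' _ (nonempty_iff_ne_empty.2 hint)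
    have := finrank_span_singleton (K := ℂ) he
    rw [htop, finrank_top] at this
    omega
  -- Both sides are continuous at x and agree on the complement of ℂe, which is dense because the
  -- dimension is at least two.
  have heq : ∀ x ∈ ball (0 : E) ‖e‖, x ≠ 0 → h x = f x := by
    intro x hx hx0
    have hxc : x ∈ closure (((ℂ ∙ e : Submodule ℂ E) : Set E)ᶜ) := hdense x
    have hnhds : (𝓝[((ℂ ∙ e : Submodule ℂ E) : Set E)ᶜ] x).NeBot :=
      mem_closure_iff_nhdsWithin_neBot.1 hxc
    have h1 : Tendsto h (𝓝[((ℂ ∙ e : Submodule ℂ E) : Set E)ᶜ] x) (𝓝 (h x)) :=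
      (hhd.continuousOn.continuousAt (isOpen_ball.mem_nhds hx)).mono_left nhdsWithin_le_nhds
    have h2 : Tendsto f (𝓝[((ℂ ∙ e : Submodule ℂ E) : Set E)ᶜ] x) (𝓝 (f x)) :=
      (hf.continuousOn.continuousAt (isOpen_compl_singleton.mem_nhds hx0)).mono_left
        nhdsWithin_le_nhds
    refine tendsto_nhds_unique (h1.congr' ?_) h2
    filter_upwards [self_mem_nhdsWithin] with y hy using hline y hy
  classical
  refine ⟨Function.update f 0 (h 0), fun x => ?_, fun x hx => Function.update_of_ne hx _ _⟩
  rcases eq_or_ne x 0 with rfl | hx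
  · refine (hhd.differentiableAt (ball_mem_nhds 0 he')).congr_of_eventuallyEq ?_
    filter_upwards [ball_mem_nhds (0 : E) he'] with y hy
    rcases eq_or_ne y 0 with rfl | hy0
    · simp
    · rw [Function.update_of_ne hy0, heq y hy hy0]
  · refine (hf.differentiableAt (isOpen_compl_singleton.mem_nhds hx)).congr_of_eventuallyEq ?_
    filter_upwards [isOpen_compl_singleton.mem_nhds hx] with y hy
    exact Function.update_of_ne hy _ _

end SeveralComplexVariables

/-! ### Lifting maps from a punctured space through coverings -/

section PuncturedSpaceLift

variable {E : Type*} [NormedAddCommGroup E] [NormedSpace ℝ E]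

/-- The complement of the closed ray from the origin through `e`. -/
def rayCompl (e : E) : Set E := {z | ∀ t : ℝ, 0 ≤ t → z ≠ t • e}

theorem isOpen_rayCompl {e : E} (he : e ≠ 0) : IsOpen (rayCompl e) := by
  have h : rayCompl e = ((fun t : ℝ => t • e) '' Ici 0)ᶜ := by
    ext z
    simp only [rayCompl, mem_ofPred_eq, mem_compl_iff, mem_image, mem_Ici, not_exists, not_and]
    exact forall₂_congr fun t _ => ne_comm
  rw [h, isOpen_compl_iff]
  exact (isClosedEmbedding_smul_left he).isClosedMap _ isClosed_Ici

theorem neg_mem_rayCompl {e : E} (he : e ≠ 0) : -e ∈ rayCompl e := by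
  intro t ht h
  have h1 : (t + 1) • e = 0 := by rw [add_smul, one_smul, ← h, neg_add_cancel]
  rcases smul_eq_zero.1 h1 with h2 | h2
  · linarith
  · exact he h2

theorem starConvex_rayCompl {e : E} (he : e ≠ 0) : StarConvex ℝ (-e) (rayCompl e) := by
  intro z hz a b ha hb hab t ht h
  rcases hb.eq_or_lt with rfl | hb
  · rw [add_zero] at hab
    rw [hab, one_smul, zero_smul, add_zero] at h
    exact neg_mem_rayCompl he t ht h
  · refine hz ((t + a) / b) (by positivity) ?_
    have h1 : b • z = (t + a) • e := by
      rw [add_smul, ← h, smul_neg]; abel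
    rw [div_eq_inv_mul, mul_smul, ← h1, inv_smul_smul₀ hb.ne']

theorem rayCompl_inter_rayCompl_neg (e : E) :
    rayCompl e ∩ rayCompl (-e) = ((ℝ ∙ e : Submodule ℝ E) : Set E)ᶜ := by
  ext z
  simp only [rayCompl, mem_inter_iff, mem_ofPred_eq, mem_compl_iff, SetLike.mem_coe,
    Submodule.mem_span_singleton, not_exists]
  constructor
  · rintro ⟨h1, h2⟩ t ht
    rcases le_total 0 t with h | h
    · exact h1 t h ht.symm
    · exact h2 (-t) (neg_nonneg.2 h) (by rw [smul_neg, neg_smul, neg_neg, ht])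
  · intro h
    exact ⟨fun t _ ht => h t ht.symm, fun t _ ht => h (-t) (by rw [neg_smul, ht, smul_neg])⟩

theorem mem_rayCompl_neg_of_notMem {e z : E} (he : e ≠ 0) (hz : z ≠ 0) (h : z ∉ rayCompl e) :
    z ∈ rayCompl (-e) := by
  simp only [rayCompl, mem_ofPred_eq, not_forall, not_not] at h
  obtain ⟨t, ht, rfl⟩ := h
  intro s hs h
  have h1 : (t + s) • e = 0 := by rw [add_smul, h, smul_neg, neg_add_cancel]
  rcases smul_eq_zero.1 h1 with h2 | h2
  · have : t = 0 := by linarith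
    simp [this] at hz
  · exact he h2

theorem rayCompl_subset (e : E) : rayCompl e ⊆ Punctured (0 : E) := by
  rintro z hz (rfl : z = 0)
  exact hz 0 le_rfl (zero_smul ℝ e).symm

/-- The ray complement is open and star-shaped, hence locally path connected and contractible, so
the lifting criterion applies. -/
theorem IsCoveringMap.exists_lift_rayCompl {X Y : Type*} [TopologicalSpace X] [TopologicalSpace Y]
    {p : Y → X} (hp : IsCoveringMap p) {e : E} (he : e ≠ 0) {f : Punctured (0 : E) → X}
    (hf : Continuous f) (a : rayCompl e) (y : Y) (hy : p y = f ⟨a, rayCompl_subset e a.2⟩) :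
    ∃ g : rayCompl e → Y, Continuous g ∧ g a = y ∧
      ∀ z : rayCompl e, p (g z) = f ⟨z, rayCompl_subset e z.2⟩ := by
  have := (starConvex_rayCompl he).contractibleSpace ⟨_, neg_mem_rayCompl he⟩
  have : LocallyPathConnectedSpace (rayCompl e) := (isOpen_rayCompl he).locallyPathConnectedSpace
  obtain ⟨g, ⟨hg, hpg⟩, -⟩ := hp.existsUnique_continuousMap_lifts
    (⟨fun z : rayCompl e => f ⟨z, rayCompl_subset e z.2⟩, by fun_prop⟩ : C(rayCompl e, X)) a y hy
  exact ⟨g, g.continuous, hg, fun z => congrFun hpg z⟩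

/-- Maps from a punctured real vector space of dimension at least three lift through coverings. -/
theorem IsCoveringMap.exists_lift_punctured (hE : ∀ e : E, 1 < Module.rank ℝ (E ⧸ (ℝ ∙ e)))
    {X Y : Type*} [TopologicalSpace X] [TopologicalSpace Y]
    {p : Y → X} (hp : IsCoveringMap p) {f : Punctured (0 : E) → X}
    (hf : Continuous f) (a : Punctured (0 : E)) (y : Y) (hy : p y = f a) :
    ∃ g : Punctured (0 : E) → Y, Continuous g ∧ g a = y ∧ ∀ z, p (g z) = f z := by
  classical
  have ha : (a : E) ≠ 0 := a.2
  -- With this choice the base point a is the star centre -e of `rayCompl e`.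
  set e : E := -a with he_def
  have he : e ≠ 0 := neg_ne_zero.2 ha
  have hne : -e ≠ 0 := neg_ne_zero.2 he
  have haU : (a : E) ∈ rayCompl e := by simpa [he_def] using neg_mem_rayCompl he
  obtain ⟨g, hg, hga, hpg⟩ := hp.exists_lift_rayCompl he hf ⟨a, haU⟩ y hy
  -- The two opposite ray complements cover the punctured space and meet in the complement of a real
  -- line. Its connectedness lets the two lifts, matched at one point b, agree on the overlap.
  have hconn : IsConnected (rayCompl e ∩ rayCompl (-e)) := by
    rw [rayCompl_inter_rayCompl_neg]
    exact isConnected_compl_of_one_lt_codim (hE e)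
  obtain ⟨b, hbU, hbV⟩ := hconn.nonempty
  obtain ⟨g', hg', hgb, hpg'⟩ := hp.exists_lift_rayCompl hne hf ⟨b, hbV⟩ (g ⟨b, hbU⟩) (hpg _)
  have hagree : ∀ z (hz : z ∈ rayCompl e) (hz' : z ∈ rayCompl (-e)), g ⟨z, hz⟩ = g' ⟨z, hz'⟩ := by
    intro z hz hz'
    have : PreconnectedSpace ↥(rayCompl e ∩ rayCompl (-e)) :=
      Subtype.preconnectedSpace hconn.isPreconnected
    have := hp.eq_of_comp_eq
      (g₁ := fun w : ↥(rayCompl e ∩ rayCompl (-e)) => g ⟨w, w.2.1⟩) (g₂ := fun w => g' ⟨w, w.2.2⟩)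
      (by fun_prop) (by fun_prop) (funext fun w => (hpg ⟨w, w.2.1⟩).trans (hpg' ⟨w, w.2.2⟩).symm)
      ⟨b, hbU, hbV⟩ hgb.symm
    exact congrFun this ⟨z, hz, hz'⟩
  have hV : ∀ z : Punctured (0 : E), (z : E) ∉ rayCompl e → (z : E) ∈ rayCompl (-e) := fun z h =>
    mem_rayCompl_neg_of_notMem he z.2 h
  set G : Punctured (0 : E) → Y := fun z =>
    if h : (z : E) ∈ rayCompl e then g ⟨z, h⟩ else g' ⟨z, hV z h⟩ with hG
  have hGU : ∀ (z : Punctured (0 : E)) (h : (z : E) ∈ rayCompl e), G z = g ⟨z, h⟩ := fun z h => dif_pos h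
  have hGV : ∀ (z : Punctured (0 : E)) (h : (z : E) ∈ rayCompl (-e)), G z = g' ⟨z, h⟩ := by
    intro z h
    by_cases h' : (z : E) ∈ rayCompl e
    · rw [hGU z h', hagree z h' h]
    · exact dif_neg h'
  have cont : ∀ (c : E) (k : rayCompl c → Y), c ≠ 0 → Continuous k →
      (∀ (z : Punctured (0 : E)) (h : (z : E) ∈ rayCompl c), G z = k ⟨z, h⟩) →
      ∀ z : Punctured (0 : E), (z : E) ∈ rayCompl c → ContinuousAt G z := by
    intro c k hc hk hGk z hz
    have hopen : IsOpen {z : Punctured (0 : E) | (z : E) ∈ rayCompl c} :=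
      (isOpen_rayCompl hc).preimage continuous_subtype_val
    refine ContinuousOn.continuousAt (s := {z : Punctured (0 : E) | (z : E) ∈ rayCompl c}) ?_
      (hopen.mem_nhds hz)
    rw [continuousOn_iff_continuous_domRestrict]
    have : ({z : Punctured (0 : E) | (z : E) ∈ rayCompl c}).domRestrict G =
        fun w => k ⟨w.1, w.2⟩ := funext fun w => hGk w.1 w.2
    rw [this]
    fun_prop
  refine ⟨G, continuous_iff_continuousAt.2 fun z => ?_, ?_, fun z => ?_⟩
  · by_cases h : (z : E) ∈ rayCompl e
    · exact cont e g he hg hGU z h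
    · exact cont (-e) g' hne hg' hGV z (hV z h)
  · rw [hGU a haU, hga]
  · by_cases h : (z : E) ∈ rayCompl e
    · rw [hGU z h, hpg]
    · rw [hGV z (hV z h), hpg']

end PuncturedSpaceLift

theorem one_lt_rank_quotient_span_singleton {E : Type*} [NormedAddCommGroup E] [NormedSpace ℂ E]
    (hE : 2 ≤ Module.finrank ℂ E) (e : E) : 1 < Module.rank ℝ (E ⧸ (ℝ ∙ e)) := by
  have hfin : FiniteDimensional ℂ E := Module.finite_of_finrank_pos (by omega)
  have : FiniteDimensional ℝ E := FiniteDimensional.complexToReal E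
  have h1 : Module.finrank ℝ E = 2 * Module.finrank ℂ E := finrank_real_of_complex E
  have h2 := Submodule.finrank_quotient_add_finrank (ℝ ∙ e)
  have h3 : Module.finrank ℝ (ℝ ∙ e) ≤ 1 := by
    simpa using finrank_span_le_card (R := ℝ) ({e} : Set E)
  rw [← Module.finrank_eq_rank]
  exact_mod_cast (by omega : 1 < Module.finrank ℝ (E ⧸ (ℝ ∙ e)))

/-! ### Smooth maps into and out of a quotient manifold -/

section QuotientManifold

theorem isLocalHomeomorph_quotientMk {M : Type*} [TopologicalSpace M] [T2Space M]
    [LocallyCompactSpace M] (Γ : Subgroup (M ≃ₜ M))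
    [ProperlyDiscontinuousSMul Γ M] [ContinuousConstSMul Γ M] [IsCancelSMul Γ M] :
    IsLocalHomeomorph (Quotient.mk (MulAction.orbitRel Γ M)) :=
  (isQuotientCoveringMap_quotientMk_of_properlyDiscontinuousSMul
    (G := Γ)).isCoveringMap.isLocalHomeomorph

/-- The chart at p comes from a chosen representative x, which differs from a given one by an
element of Γ; the proofs below correct for this. -/
theorem exists_chartAt_quotient_eq {H₀ : Type*} [TopologicalSpace H₀] {M : Type*}
    [TopologicalSpace M] [T2Space M] [LocallyCompactSpace M] [ChartedSpace H₀ M]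
    (Γ : Subgroup (M ≃ₜ M))
    [ProperlyDiscontinuousSMul Γ M] [ContinuousConstSMul Γ M] [IsCancelSMul Γ M]
    (p : MulAction.orbitRel.Quotient Γ M) :
    ∃ x : M, Quotient.mk _ x = p ∧ chartAt H₀ p =
      ((isLocalHomeomorph_quotientMk Γ).localInverseAt x).trans (chartAt H₀ x) :=
  ⟨_, (Quotient.mk_surjective (s := MulAction.orbitRel Γ M)).hasRightInverse.choose_spec p, rfl⟩

variable {𝕜 : Type*} [NontriviallyNormedField 𝕜] {E : Type*} [NormedAddCommGroup E]
  [NormedSpace 𝕜 E] {H₀ : Type*} [TopologicalSpace H₀] (I : ModelWithCorners 𝕜 E H₀) (n : ℕ∞ω)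
  {M : Type*} [TopologicalSpace M] [T2Space M] [LocallyCompactSpace M] [ChartedSpace H₀ M]
  [IsManifold I n M] (Γ : Subgroup (M ≃ₜ M))
  [ProperlyDiscontinuousSMul Γ M] [ContinuousConstSMul Γ M] [IsCancelSMul Γ M]
  [IsManifold I n (MulAction.orbitRel.Quotient Γ M)]

/-- At the chosen representative the quotient map is a chart followed by an inverse chart; elsewhere
precompose with the γ that moves z there. -/
theorem contMDiff_quotientMk (hΓ : ∀ γ ∈ Γ, ContMDiff I I n γ) :
    ContMDiff I I n (Quotient.mk (MulAction.orbitRel Γ M)) := by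
  intro z
  set q : M → MulAction.orbitRel.Quotient Γ M := Quotient.mk (MulAction.orbitRel Γ M)
  obtain ⟨x, hxp, hchart⟩ := exists_chartAt_quotient_eq (H₀ := H₀) Γ (q z)
  set σ := (isLocalHomeomorph_quotientMk Γ).localInverseAt x with hσ
  have hσs : ∀ a, σ.symm a = q a := fun a =>
    congrFun ((isLocalHomeomorph_quotientMk Γ).localInverseAt_symm x) a
  set c := chartAt H₀ x
  have hxσ : x ∈ σ.target := (isLocalHomeomorph_quotientMk Γ).self_mem_localInverseAt_target
  have hqx : ContMDiffAt I I n q x := by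
    have h1 : ContMDiffAt I I n c x := contMDiffAt_of_mem_maximalAtlas
      (IsManifold.chart_mem_maximalAtlas x) (mem_chart_source H₀ x)
    have hcx : c x ∈ (chartAt H₀ (q z)).target := by
      rw [hchart, OpenPartialHomeomorph.trans_target]
      exact ⟨c.map_source (mem_chart_source H₀ x), by
        rw [mem_preimage, c.left_inv (mem_chart_source H₀ x)]; exact hxσ⟩
    have h2 : ContMDiffAt I I n (chartAt H₀ (q z)).symm (c x) :=
      contMDiffAt_symm_of_mem_maximalAtlas (IsManifold.chart_mem_maximalAtlas (q z)) hcx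
    refine (h2.comp x h1).congr_of_eventuallyEq ?_
    filter_upwards [c.open_source.mem_nhds (mem_chart_source H₀ x)] with w hw
    rw [Function.comp_apply, hchart, OpenPartialHomeomorph.trans_symm_eq_symm_trans_symm,
      OpenPartialHomeomorph.trans_apply, c.left_inv hw, hσs]
  obtain ⟨γ, hγ⟩ : ∃ γ : Γ, γ • z = x := Quotient.exact hxp
  have hqγ : q = q ∘ (γ : M ≃ₜ M) := by
    funext w
    exact Quotient.sound ⟨γ⁻¹, inv_smul_smul γ w⟩
  change ContMDiffAt I I n q z
  rw [hqγ]
  have hγ' : (γ : M ≃ₜ M) z = x := hγ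
  exact ContMDiffAt.comp z (by rw [hγ']; exact hqx) (hΓ γ γ.2 z)

/-- The section is the local inverse at the chosen representative x followed by the γ⁻¹ taking x to
z. Both smoothness criteria below compose with it. -/
theorem exists_contMDiffAt_section_quotientMk (hΓ : ∀ γ ∈ Γ, ContMDiff I I n γ) (z : M) :
    ∃ s : MulAction.orbitRel.Quotient Γ M → M, s (Quotient.mk _ z) = z ∧
      ContMDiffAt I I n s (Quotient.mk _ z) ∧
      (∀ᶠ p in 𝓝 (Quotient.mk (MulAction.orbitRel Γ M) z),
        Quotient.mk (MulAction.orbitRel Γ M) (s p) = p) ∧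
      ∀ᶠ w in 𝓝 z, s (Quotient.mk _ w) = w := by
  set q : M → MulAction.orbitRel.Quotient Γ M := Quotient.mk (MulAction.orbitRel Γ M)
  obtain ⟨x, hxp, hchart⟩ := exists_chartAt_quotient_eq (H₀ := H₀) Γ (q z)
  set σ := (isLocalHomeomorph_quotientMk Γ).localInverseAt x with hσ
  have hσs : ∀ a, σ.symm a = q a := fun a =>
    congrFun ((isLocalHomeomorph_quotientMk Γ).localInverseAt_symm x) a
  set c := chartAt H₀ x
  have hxσ : x ∈ σ.target := (isLocalHomeomorph_quotientMk Γ).self_mem_localInverseAt_target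
  have hpσ : q z ∈ σ.source := by
    rw [← hxp]
    exact (isLocalHomeomorph_quotientMk Γ).apply_self_mem_localInverseAt_source
  have hσp : σ (q z) = x := by
    rw [← hxp]; exact (isLocalHomeomorph_quotientMk Γ).localInverseAt_apply_self
  have hsmooth : ContMDiffAt I I n σ (q z) := by
    have h1 : ContMDiffAt I I n (chartAt H₀ (q z)) (q z) := contMDiffAt_of_mem_maximalAtlas
      (IsManifold.chart_mem_maximalAtlas (q z)) (mem_chart_source H₀ (q z))
    have hval : ∀ p, chartAt H₀ (q z) p = c (σ p) := fun p => by
      rw [hchart]; rfl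
    have h2 : ContMDiffAt I I n c.symm (chartAt H₀ (q z) (q z)) := by
      rw [hval, hσp]
      exact contMDiffAt_symm_of_mem_maximalAtlas (IsManifold.chart_mem_maximalAtlas x) (mem_chart_target H₀ x)
    refine (h2.comp (q z) h1).congr_of_eventuallyEq ?_
    have hcs : (chartAt H₀ (q z)).source ∈ 𝓝 (q z) := chart_source_mem_nhds H₀ (q z)
    filter_upwards [hcs] with p hp
    rw [hchart, OpenPartialHomeomorph.trans_source] at hp
    rw [Function.comp_apply, hval, c.left_inv hp.2]
  obtain ⟨γ, hγ⟩ : ∃ γ : Γ, γ • z = x := Quotient.exact hxp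
  have hγ' : (γ : M ≃ₜ M) z = x := hγ
  have hqγ : ∀ (γ : Γ) w, q ((γ : M ≃ₜ M) w) = q w := fun γ w => Quotient.sound ⟨γ, rfl⟩
  refine ⟨fun p => (γ⁻¹ : Γ).1 (σ p), ?_, ?_, ?_, ?_⟩
  · change (γ⁻¹ : Γ).1 (σ (q z)) = z
    rw [hσp, ← hγ]
    exact inv_smul_smul γ z
  · exact (hΓ _ (γ⁻¹ : Γ).2 _).comp (q z) hsmooth
  · filter_upwards [σ.open_source.mem_nhds hpσ] with p hp
    change q ((γ⁻¹ : Γ).1 (σ p)) = p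
    rw [hqγ, ← hσs, σ.left_inv hp]
  · have hnear : (γ : M ≃ₜ M) ⁻¹' σ.target ∈ 𝓝 z :=
      (γ : M ≃ₜ M).continuous.continuousAt.preimage_mem_nhds
        (σ.open_target.mem_nhds (by rw [hγ']; exact hxσ))
    filter_upwards [hnear] with w hw
    rw [← hqγ γ w, ← hσs, σ.right_inv hw]
    exact inv_smul_smul γ w

variable {E' : Type*} [NormedAddCommGroup E'] [NormedSpace 𝕜 E'] {H' : Type*}
  [TopologicalSpace H'] {I' : ModelWithCorners 𝕜 E' H'} {N : Type*} [TopologicalSpace N]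
  [ChartedSpace H' N]

variable {I n Γ}

/-- A map on a quotient manifold is smooth at a point if its pullback is. -/
theorem ContMDiffAt.of_comp_quotientMk (hΓ : ∀ γ ∈ Γ, ContMDiff I I n γ)
    {f : MulAction.orbitRel.Quotient Γ M → N} {z : M}
    (hf : ContMDiffAt I I' n (fun w => f (Quotient.mk _ w)) z) :
    ContMDiffAt I I' n f (Quotient.mk _ z) := by
  obtain ⟨s, hsz, hs, hqs, -⟩ := exists_contMDiffAt_section_quotientMk I n Γ hΓ z
  rw [← hsz] at hf
  refine (hf.comp _ hs).congr_of_eventuallyEq ?_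
  filter_upwards [hqs] with p hp
  rw [Function.comp_apply, hp]

/-- A continuous lift of a smooth map to a quotient manifold is smooth. -/
theorem ContMDiffAt.of_quotientMk_comp (hΓ : ∀ γ ∈ Γ, ContMDiff I I n γ)
    {f : N → M} {y : N} (hfc : ContinuousAt f y)
    (hf : ContMDiffAt I' I n (fun w => (Quotient.mk _ (f w) : MulAction.orbitRel.Quotient Γ M)) y) :
    ContMDiffAt I' I n f y := by
  obtain ⟨s, -, hs, -, hsq⟩ := exists_contMDiffAt_section_quotientMk I n Γ hΓ (f y)
  refine (ContMDiffAt.comp y hs hf).congr_of_eventuallyEq ?_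
  filter_upwards [hfc.eventually hsq] with w hw
  exact hw.symm

end QuotientManifold

/-! ### Automorphisms induced on the quotient -/

section QuotientHomeomorph

variable {M : Type*} [TopologicalSpace M] (Γ : Subgroup (M ≃ₜ M))

/-- The homeomorphism of the quotient induced by a homeomorphism that commutes with the group. -/
def quotientHomeo (Φ : M ≃ₜ M) (hΦ : ∀ γ ∈ Γ, γ * Φ = Φ * γ) :
    MulAction.orbitRel.Quotient Γ M ≃ₜ MulAction.orbitRel.Quotient Γ M where
  toFun := Quotient.map Φ <| by
    rintro _ z ⟨γ, rfl⟩
    exact ⟨γ, DFunLike.congr_fun (hΦ γ γ.2) z⟩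
  invFun := Quotient.map Φ.symm <| by
    rintro _ z ⟨γ, rfl⟩
    refine ⟨γ, ?_⟩
    rw [Homeomorph.eq_symm_apply]
    refine (DFunLike.congr_fun (hΦ γ γ.2) (Φ.symm z)).symm.trans ?_
    exact congrArg γ.1 (Φ.apply_symm_apply z)
  left_inv := by
    rintro ⟨z⟩
    exact congrArg (Quotient.mk _) (Φ.symm_apply_apply z)
  right_inv := by
    rintro ⟨z⟩
    exact congrArg (Quotient.mk _) (Φ.apply_symm_apply z)
  continuous_toFun := Φ.continuous.quotient_map' _
  continuous_invFun := Φ.symm.continuous.quotient_map' _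

/-- In charts the induced map is locally γ ∘ Φ for a suitable γ in Γ, so membership follows from
locality of the groupoid. -/
theorem quotientHomeo_mem_structureAut {H₀ : Type*} [TopologicalSpace H₀]
    (𝒢 : StructureGroupoid H₀) [ClosedUnderRestriction 𝒢] [T2Space M]
    [LocallyCompactSpace M] [ChartedSpace H₀ M] [HasGroupoid M 𝒢]
    [ProperlyDiscontinuousSMul Γ M] [ContinuousConstSMul Γ M] [IsCancelSMul Γ M]
    [HasGroupoid (MulAction.orbitRel.Quotient Γ M) 𝒢]
    (hΓ : Γ ≤ structureAut 𝒢 M) (Φ : M ≃ₜ M) (hΦ : ∀ γ ∈ Γ, γ * Φ = Φ * γ)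
    (hΦ' : Φ ∈ structureAut 𝒢 M) :
    quotientHomeo Γ Φ hΦ ∈ structureAut 𝒢 (MulAction.orbitRel.Quotient Γ M) := by
  intro e he e' he'
  have hπ := isLocalHomeomorph_quotientMk Γ
  obtain ⟨x, rfl⟩ : ∃ x : M, e = (hπ.localInverseAt x).trans (chartAt H₀ x) := by
    obtain ⟨q, rfl⟩ := he; exact ⟨_, rfl⟩
  obtain ⟨x', rfl⟩ : ∃ x : M, e' = (hπ.localInverseAt x).trans (chartAt H₀ x) := by
    obtain ⟨q, rfl⟩ := he'; exact ⟨_, rfl⟩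
  set f := quotientHomeo Γ Φ hΦ
  set c := chartAt H₀ x
  set c' := chartAt H₀ x'
  set σ := hπ.localInverseAt x with hσ
  set σ' := hπ.localInverseAt x' with hσ'
  set t := (σ.trans c).symm ≫ₕ f.toOpenPartialHomeomorph ≫ₕ σ'.trans c' with ht
  have hσs : ∀ a, σ.symm a = Quotient.mk _ a := fun a => congrFun (hπ.localInverseAt_symm x) a
  have hσs' : ∀ a, σ'.symm a = Quotient.mk _ a :=
    fun a => congrFun (hπ.localInverseAt_symm x') a
  have hfσ : ∀ a, f (σ.symm a) = Quotient.mk _ (Φ a) := fun a => by rw [hσs]; rfl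
  refine 𝒢.locality fun y hy => ?_
  have hyc : y ∈ c.target := hy.1.1
  have hys : Quotient.mk _ (Φ (c.symm y)) ∈ σ'.source := by
    rw [← hfσ]; exact hy.2.2.1
  obtain ⟨γ, hγ⟩ : ∃ γ : Γ, γ • Φ (c.symm y) = σ' (Quotient.mk _ (Φ (c.symm y))) := by
    have : (Quotient.mk (MulAction.orbitRel Γ M) (σ' (Quotient.mk _ (Φ (c.symm y))))) =
        Quotient.mk _ (Φ (c.symm y)) := by rw [← hσs', σ'.left_inv hys]
    exact Quotient.exact this
  set Ψ : M ≃ₜ M := γ.1 * Φ with hΨ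
  have hΨa : ∀ a, Ψ a = γ • Φ a := fun a => rfl
  have hmem : c.symm ≫ₕ Ψ.toOpenPartialHomeomorph ≫ₕ c' ∈ 𝒢 :=
    (structureAut 𝒢 M).mul_mem (hΓ γ.2) hΦ' c (chart_mem_atlas _ _) c' (chart_mem_atlas _ _)
  -- On `s` the map γ ∘ Φ stays in the sheet `σ'.target`, so the same γ serves throughout.
  set s : Set H₀ := t.source ∩ (c.target ∩ c.symm ⁻¹' (Ψ ⁻¹' σ'.target)) with hs
  have hso : IsOpen s :=
    t.open_source.inter (c.symm.continuousOn.isOpen_inter_preimage c.open_target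
      (σ'.open_target.preimage Ψ.continuous))
  have key : ∀ z ∈ s, σ' (f (σ.symm (c.symm z))) = Ψ (c.symm z) := by
    rintro z ⟨-, -, hz⟩
    have : (Quotient.mk (MulAction.orbitRel Γ M) (Φ (c.symm z))) =
        Quotient.mk _ (Ψ (c.symm z)) := Quotient.sound ⟨γ⁻¹, inv_smul_smul γ (Φ (c.symm z))⟩
    rw [hfσ, this, ← hσs', σ'.right_inv hz]
  have hval : ∀ z ∈ s, t z = c' (Ψ (c.symm z)) := by
    intro z hz
    rw [← key z hz]
    rfl
  refine ⟨s, hso, ⟨hy, hyc, ?_⟩, ?_⟩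
  · change Ψ (c.symm y) ∈ σ'.target
    rw [hΨa, hγ]
    exact σ'.map_source hys
  · refine 𝒢.mem_of_eqOnSource (closedUnderRestriction' hmem hso) ⟨?_, fun z hz => ?_⟩
    · rw [OpenPartialHomeomorph.restr_source' _ _ hso, OpenPartialHomeomorph.restr_source' _ _ hso]
      ext z
      refine ⟨fun hz => ⟨⟨hz.2.2.1, mem_univ _, ?_⟩, hz.2⟩, fun hz => ⟨hz.2.1, hz.2⟩⟩
      change Ψ (c.symm z) ∈ c'.source
      rw [← key z hz.2]
      exact hz.1.2.2.2
    · rw [OpenPartialHomeomorph.restr_source' _ _ hso] at hz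
      exact hval z hz.2

end QuotientHomeomorph

/-! ### Biholomorphic maps of a punctured space and expanding maps -/

theorem contMDiffAt_subtypeVal_comp_iff {𝕜 : Type*} [NontriviallyNormedField 𝕜]
    {E H M E' H' M' : Type*} [NormedAddCommGroup E] [NormedSpace 𝕜 E] [TopologicalSpace H]
    {I : ModelWithCorners 𝕜 E H} [TopologicalSpace M] [ChartedSpace H M]
    [NormedAddCommGroup E'] [NormedSpace 𝕜 E'] [TopologicalSpace H']
    {I' : ModelWithCorners 𝕜 E' H'} [TopologicalSpace M'] [ChartedSpace H' M'] {k : ℕ∞ω}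
    {U : Opens M'} {f : M → U} {x : M} :
    ContMDiffAt I I' k (fun y => (f y : M')) x ↔ ContMDiffAt I I' k f x :=
  ChartedSpace.liftPropWithinAt_subtypeVal_comp_iff ..

theorem puncturedHomeo_mem_holomorphicAut {E : Type*} [NormedAddCommGroup E] [NormedSpace ℂ E]
    (F : E ≃ₘ^ω⟮𝓘(ℂ, E), 𝓘(ℂ, E)⟯ E) (hF : F 0 = 0) :
    puncturedHomeo F.toHomeomorph hF ∈ holomorphicAut E (Punctured (0 : E)) := by
  constructor
  · exact fun z => contMDiffAt_subtypeVal_comp_iff.1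
      ((F.contMDiff.comp contMDiff_subtype_val) z)
  · exact fun z => contMDiffAt_subtypeVal_comp_iff.1
      ((F.symm.contMDiff.comp contMDiff_subtype_val) z)

theorem ContMDiff.differentiableOn_extend_punctured {E : Type*} [NormedAddCommGroup E]
    [NormedSpace ℂ E] {f : Punctured (0 : E) → Punctured (0 : E)}
    (hf : ContMDiff 𝓘(ℂ, E) 𝓘(ℂ, E) ω f) (f' : E → E)
    (hff' : ∀ z : Punctured (0 : E), f' z = f z) : DifferentiableOn ℂ f' {0}ᶜ := by
  intro z hz
  have h1 : ContMDiffAt 𝓘(ℂ, E) 𝓘(ℂ, E) ω (fun w : Punctured (0 : E) => f' w)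
      (⟨z, hz⟩ : Punctured (0 : E)) := by
    rw [show (fun w : Punctured (0 : E) => f' w) = fun w => (f w : E) from funext hff']
    exact contMDiffAt_subtypeVal_comp_iff.2 (hf _)
  exact ((contMDiffAt_subtype_iff.1 h1).contDiffAt.differentiableAt (by simp)).differentiableWithinAt

/-- Biholomorphic maps of a punctured complex vector space of dimension at least two extend across
the puncture. -/
theorem exists_diffeomorph_extension {E : Type*} [NormedAddCommGroup E] [NormedSpace ℂ E]
    (hE : 2 ≤ Module.finrank ℂ E) {Φ : Punctured (0 : E) ≃ₜ Punctured (0 : E)}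
    (hΦ : Φ ∈ holomorphicAut E (Punctured (0 : E))) :
    ∃ (F : E ≃ₘ^ω⟮𝓘(ℂ, E), 𝓘(ℂ, E)⟯ E) (hF : F 0 = 0),
      puncturedHomeo F.toHomeomorph hF = Φ := by
  classical
  have : FiniteDimensional ℂ E := Module.finite_of_finrank_pos (by omega)
  have : Nontrivial E := Module.nontrivial_of_finrank_pos (R := ℂ) (by omega)
  have ext : ∀ f : Punctured (0 : E) → Punctured (0 : E), ContMDiff 𝓘(ℂ, E) 𝓘(ℂ, E) ω f →
      ∃ F : E → E, Differentiable ℂ F ∧ ∀ z : Punctured (0 : E), F z = f z := by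
    intro f hf
    set f' : E → E := fun z => if hz : z ≠ 0 then f ⟨z, hz⟩ else 0
    have hff' : ∀ z : Punctured (0 : E), f' z = f z := fun z => dif_pos z.2
    obtain ⟨F, hF, hFf⟩ :=
      (hf.differentiableOn_extend_punctured f' hff').exists_differentiable_extension hE
    exact ⟨F, hF, fun z => (hFf z.2).trans (hff' z)⟩
  obtain ⟨F, hF, hFΦ⟩ := ext Φ hΦ.1
  obtain ⟨K, hK, hKΦ⟩ := ext Φ.symm hΦ.2
  have hdense : Dense ({0}ᶜ : Set E) :=
    have := Module.punctured_nhds_neBot ℂ E 0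
    dense_compl_singleton 0
  have inv : ∀ (A B : E → E) (a b : Punctured (0 : E) → Punctured (0 : E)), Differentiable ℂ A →
      Differentiable ℂ B → (∀ z : Punctured (0 : E), A z = a z) →
      (∀ z : Punctured (0 : E), B z = b z) → (∀ z, b (a z) = z) → ∀ z, B (A z) = z := by
    intro A B a b hA hB hAa hBb hab
    refine congrFun (Continuous.ext_on hdense (hB.continuous.comp hA.continuous) continuous_id ?_)
    intro z hz
    have h1 := hAa ⟨z, hz⟩
    have h2 := hBb (a ⟨z, hz⟩)
    rw [hab, ← h1] at h2
    exact h2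
  have smooth : ∀ A : E → E, Differentiable ℂ A → ContMDiff 𝓘(ℂ, E) 𝓘(ℂ, E) ω A := by
    intro A hA
    exact (contDiffOn_univ.1 (hA.differentiableOn.analyticOnNhd_of_finiteDimensional
      isOpen_univ |>.contDiffOn uniqueDiffOn_univ)).contMDiff
  have hKF := inv F K Φ Φ.symm hF hK hFΦ hKΦ Φ.symm_apply_apply
  have hFK := inv K F Φ.symm Φ hK hF hKΦ hFΦ Φ.apply_symm_apply
  let D : E ≃ₘ^ω⟮𝓘(ℂ, E), 𝓘(ℂ, E)⟯ E :=
    ⟨⟨F, K, hKF, hFK⟩, smooth F hF, smooth K hK⟩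
  have hD : ∀ z : Punctured (0 : E), D z = Φ z := hFΦ
  -- If D 0 were nonzero, K (D 0) would be a value of Φ⁻¹, hence nonzero; but K (D 0) = 0.
  have hD0 : D 0 = 0 := by
    by_contra h
    have h1 := hKΦ ⟨D 0, h⟩
    have h2 : K (D 0) = 0 := hKF 0
    exact (Φ.symm ⟨D 0, h⟩).2 (h1.symm.trans h2)
  exact ⟨D, hD0, Homeomorph.ext fun z => Subtype.ext (hD z)⟩

/-- A convergent orbit together with its limit is compact, so some backward iterate F^{-k} would
push it off w; yet it takes F^k w to w. -/
theorem IsExpandingFrom.not_tendsto_iterate {Y : Type*} [TopologicalSpace Y] [T1Space Y]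
    {F : Y ≃ₜ Y} {p : Y} (h : IsExpandingFrom F p) {w : Y} (hw : w ≠ p) :
    ¬ Tendsto (fun k : ℕ => F^[k] w) atTop (𝓝 p) := by
  intro hlim
  obtain ⟨k, hk⟩ := (h _ hlim.isCompact_insert_range {w}ᶜ
    (isOpen_compl_singleton.mem_nhds hw.symm)).exists
  refine hk (mem_insert_of_mem _ ⟨k, rfl⟩) ?_
  exact (Function.LeftInverse.iterate F.symm_apply_apply k) w

/-! ### Lifting automorphisms of the Hopf manifold -/

namespace HopfConstruction

variable {n : ℕ} (X : HopfConstruction n)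

local notation "𝔼" => EuclideanSpace ℂ (Fin n)

/-- The quotient map onto the Hopf manifold. -/
def mkH (z : CoverH n) : X.H := Quotient.mk _ z

/-- The quotient map onto the Reeb component. -/
def mkR (z : CoverR n) : X.R := Quotient.mk _ z

theorem isCoveringMap_mkH : IsCoveringMap X.mkH :=
  (isQuotientCoveringMap_quotientMk_of_properlyDiscontinuousSMul
    (G := Subgroup.zpowers X.G₀)).isCoveringMap

theorem zpowers_G₀_le : Subgroup.zpowers X.G₀ ≤ holomorphicAut 𝔼 (CoverH n) := by
  rw [Subgroup.zpowers_le]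
  exact puncturedHomeo_mem_holomorphicAut X.G X.G_zero

theorem contMDiff_of_mem_zpowers_G₀ (γ : CoverH n ≃ₜ CoverH n) (hγ : γ ∈ Subgroup.zpowers X.G₀) :
    ContMDiff 𝓘(ℂ, 𝔼) 𝓘(ℂ, 𝔼) ω γ :=
  (X.zpowers_G₀_le hγ).1

theorem contMDiff_mkH : ContMDiff 𝓘(ℂ, 𝔼) 𝓘(ℂ, 𝔼) ω X.mkH :=
  contMDiff_quotientMk 𝓘(ℂ, 𝔼) ω _ X.contMDiff_of_mem_zpowers_G₀

theorem mkH_zpow (k : ℤ) (z : CoverH n) : X.mkH ((X.G₀ ^ k) z) = X.mkH z :=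
  Quotient.sound ⟨⟨X.G₀ ^ k, k, rfl⟩, rfl⟩

theorem exists_zpow_of_mkH_eq {z w : CoverH n} (h : X.mkH z = X.mkH w) :
    ∃ k : ℤ, z = (X.G₀ ^ k) w := by
  obtain ⟨⟨_, k, rfl⟩, hk⟩ := Quotient.exact h
  exact ⟨k, hk.symm⟩

theorem preconnectedSpace_coverH (hn : 2 ≤ n) : PreconnectedSpace (CoverH n) := by
  have h : 1 < Module.rank ℝ 𝔼 := by
    have : Module.finrank ℝ 𝔼 = 2 * n := by
      rw [finrank_real_of_complex, finrank_euclideanSpace_fin]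
    rw [← Module.finrank_eq_rank, this]
    exact_mod_cast (by omega : 1 < 2 * n)
  exact Subtype.preconnectedSpace (isConnected_compl_singleton_of_one_lt_rank h 0).isPreconnected

theorem nonempty_coverH (hn : 2 ≤ n) : Nonempty (CoverH n) := by
  have : Nontrivial 𝔼 := Module.nontrivial_of_finrank_pos (R := ℂ)
    (by rw [finrank_euclideanSpace_fin]; omega)
  obtain ⟨z, hz⟩ := exists_ne (0 : 𝔼)
  exact ⟨⟨z, hz⟩⟩

/-- Automorphisms of the Hopf manifold lift to biholomorphic maps of its covering. -/
theorem exists_lift_aut (hn : 2 ≤ n) (g : X.H ≃ₜ X.H) (hg : g ∈ X.AutH) :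
    ∃ Φ ∈ holomorphicAut 𝔼 (CoverH n), ∀ z, X.mkH (Φ z) = g (X.mkH z) := by
  have hpre := preconnectedSpace_coverH hn
  obtain ⟨z₀⟩ := nonempty_coverH hn
  have hcov := X.isCoveringMap_mkH
  have hrank : ∀ e : 𝔼, 1 < Module.rank ℝ (𝔼 ⧸ (ℝ ∙ e)) :=
    one_lt_rank_quotient_span_singleton (by rw [finrank_euclideanSpace_fin]; exact hn)
  obtain ⟨w₀, hw₀⟩ : ∃ w₀, X.mkH w₀ = g (X.mkH z₀) := Quotient.exists_rep _
  obtain ⟨a, ha, haz, hga⟩ := hcov.exists_lift_punctured hrank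
    (g.continuous.comp hcov.continuous) z₀ w₀ hw₀
  obtain ⟨b, hb, hbw, hgb⟩ := hcov.exists_lift_punctured hrank
    (g.symm.continuous.comp hcov.continuous) w₀ z₀ (by simp [hw₀])
  simp only [Function.comp_apply] at hga hgb
  -- The base points are matched so that b ∘ a is a lift of the quotient map fixing z₀; uniqueness
  -- of lifts makes it the identity.
  have hba : ∀ z, b (a z) = z := congrFun <| hcov.eq_of_comp_eq (hb.comp ha) continuous_id
    (funext fun z => by simp [hgb, hga]) z₀ (by simp [haz, hbw])
  have hab : ∀ z, a (b z) = z := congrFun <| hcov.eq_of_comp_eq (ha.comp hb) continuous_id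
    (funext fun z => by simp [hgb, hga]) w₀ (by simp [haz, hbw])
  have smooth : ∀ (c : CoverH n → CoverH n) (k : X.H ≃ₜ X.H), Continuous c →
      ContMDiff 𝓘(ℂ, 𝔼) 𝓘(ℂ, 𝔼) ω k → (∀ z, X.mkH (c z) = k (X.mkH z)) →
      ContMDiff 𝓘(ℂ, 𝔼) 𝓘(ℂ, 𝔼) ω c := by
    intro c k hc hk hck z
    refine ContMDiffAt.of_quotientMk_comp X.contMDiff_of_mem_zpowers_G₀ hc.continuousAt ?_
    exact ((hk.comp X.contMDiff_mkH).congr hck) z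
  exact ⟨⟨⟨a, b, hba, hab⟩, ha, hb⟩, ⟨smooth a g ha hg.1 hga, smooth b g.symm hb hg.2 hgb⟩, hga⟩

/-- Both sides lift the same map to `H`. One point determines k, and uniqueness of lifts on a
connected space does the rest. -/
theorem exists_zpow_of_lift (hn : 2 ≤ n) {g : X.H ≃ₜ X.H} {Φ : CoverH n ≃ₜ CoverH n}
    (hΦ : ∀ z, X.mkH (Φ z) = g (X.mkH z)) : ∃ k : ℤ, Φ * X.G₀ = X.G₀ ^ k * Φ := by
  have hpre := preconnectedSpace_coverH hn
  obtain ⟨z₀⟩ := nonempty_coverH hn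
  have hG : ∀ z, X.mkH (X.G₀ z) = X.mkH z := fun z => by simpa using X.mkH_zpow 1 z
  obtain ⟨k, hk⟩ : ∃ k : ℤ, Φ (X.G₀ z₀) = (X.G₀ ^ k) (Φ z₀) :=
    X.exists_zpow_of_mkH_eq (by rw [hΦ, hΦ, hG])
  refine ⟨k, Homeomorph.ext (congrFun (X.isCoveringMap_mkH.eq_of_comp_eq
    (Φ * X.G₀).continuous (X.G₀ ^ k * Φ).continuous (funext fun z => ?_) z₀ hk))⟩
  change X.mkH (Φ (X.G₀ z)) = X.mkH ((X.G₀ ^ k) (Φ z))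
  rw [X.mkH_zpow, hΦ, hΦ, hG]

/-- Expansion moves every point off itself under high backward iterates, so `G₀` has infinite order.
-/
theorem G₀_zpow_eq_self {m : ℤ} (hn : 2 ≤ n) (h : X.G₀ ^ m = X.G₀) : m = 1 := by
  obtain ⟨z₀⟩ := nonempty_coverH hn
  have key : ∀ m : ℕ, X.G₀ ^ m = 1 → m = 0 := by
    intro m hm
    by_contra hm0
    obtain ⟨N, hN⟩ := eventually_atTop.1 (X.G_expanding.disjoint X.G_zero
      (isCompact_singleton (x := z₀)) (isCompact_singleton (x := z₀)))
    refine hN (m * N) (Nat.le_mul_of_pos_left N (Nat.pos_of_ne_zero hm0)) z₀ rfl ?_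
    change ((X.G₀)⁻¹ ^ (m * N)) z₀ = z₀
    rw [pow_mul, inv_pow, hm, inv_one, one_pow]
    rfl
  have h1 : X.G₀ ^ (m - 1) = 1 := by rw [zpow_sub_one, h, mul_inv_cancel]
  have h2 : (m - 1).natAbs = 0 := by
    refine key _ ?_
    rcases Int.natAbs_eq (m - 1) with h3 | h3
    · rwa [h3, zpow_natCast] at h1
    · rwa [h3, zpow_neg, zpow_natCast, inv_eq_one] at h1
  omega

/-- A lift of an automorphism of the Hopf manifold that extends continuously to the origin commutes
with the deck transformations. -/
theorem commute_of_lift (hn : 2 ≤ n) {g : X.H ≃ₜ X.H} {F : 𝔼 ≃ₜ 𝔼} (hF : F 0 = 0)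
    (hΦ : ∀ z, X.mkH (puncturedHomeo F hF z) = g (X.mkH z)) :
    Commute X.G₀ (puncturedHomeo F hF) := by
  set Φ := puncturedHomeo F hF with hΦdef
  obtain ⟨k, hk⟩ := X.exists_zpow_of_lift hn hΦ
  obtain ⟨l, hl⟩ := X.exists_zpow_of_lift hn (g := g.symm) (Φ := Φ⁻¹) (fun z => by
    have := hΦ (Φ⁻¹ z)
    rw [show Φ (Φ⁻¹ z) = z from Φ.apply_symm_apply z] at this
    rw [this, g.symm_apply_apply])
  have hk' : Φ * X.G₀ * Φ⁻¹ = X.G₀ ^ k := by rw [hk, mul_inv_cancel_right]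
  have hl' : Φ⁻¹ * X.G₀ * Φ = X.G₀ ^ l := by rw [hl, inv_mul_cancel_right]
  -- Conjugating by Φ and then back multiplies the exponents, so k l = 1.
  have hkl : X.G₀ ^ (k * l) = X.G₀ := by
    rw [zpow_mul, ← hk', conj_zpow, ← hl']
    group
  rcases Int.mul_eq_one_iff_eq_one_or_neg_one.1 (X.G₀_zpow_eq_self hn hkl) with ⟨h1, -⟩ | ⟨h1, -⟩
  · rw [h1, zpow_one] at hk
    exact hk.symm
  · exfalso
    rw [h1, zpow_neg_one] at hk
    -- For k = -1 this yields Φ ∘ G₀^{-m} = G₀^m ∘ Φ. The left side tends to 0 by continuity of F at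
    -- 0, so a forward orbit of G would converge to 0.
    have hcomm : SemiconjBy Φ X.G₀⁻¹ X.G₀ := by
      have : SemiconjBy Φ X.G₀ X.G₀⁻¹ := hk
      simpa using this.inv_right
    obtain ⟨z₀⟩ := nonempty_coverH hn
    refine X.G_expanding.not_tendsto_iterate (w := Φ z₀) (Φ z₀).2 ?_
    have hpow : ∀ (m : ℕ) (z : CoverH n), (((X.G₀ ^ m) z : CoverH n) : 𝔼) =
        (X.G.toHomeomorph)^[m] z := by
      intro m
      induction m with
      | zero => intro z; rfl
      | succ m ih => intro z; rw [pow_succ, Function.iterate_succ_apply]; exact ih (X.G₀ z)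
    have hz : Tendsto (fun m : ℕ => (X.G.toHomeomorph.symm)^[m] (z₀ : 𝔼)) atTop (𝓝 0) := by
      rw [tendsto_def]
      intro U hU
      filter_upwards [X.G_expanding {(z₀ : 𝔼)} isCompact_singleton U hU] with m hm
      exact hm rfl
    have hFz := (F.continuous.tendsto 0).comp hz
    rw [hF] at hFz
    refine hFz.congr fun m => ?_
    rw [← hpow, Function.comp_apply, ← puncturedHomeo_symm_pow_coe X.G.toHomeomorph X.G_zero]
    exact congrArg Subtype.val (DFunLike.congr_fun (hcomm.pow_right m) z₀)

end HopfConstruction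

/-! ### Invariance of the boundary -/

/-- A nonnegative function that is continuous and injective near an interior point of `[0, ∞)` does
not vanish there. -/
theorem ne_zero_of_eventually_injOn {h : ℝ≥0 → ℝ≥0} {y₀ : ℝ≥0} (hy₀ : 0 < y₀) {s : Set ℝ≥0}
    (hs : s ∈ 𝓝 y₀) (hc : ContinuousOn h s) (hi : InjOn h s) : h y₀ ≠ 0 := by
  intro h0
  obtain ⟨a, ha, has⟩ := exists_Ioc_subset_of_mem_nhds hs ⟨0, hy₀⟩
  obtain ⟨b, hb, hbs⟩ := exists_Ico_subset_of_mem_nhds hs ⟨y₀ + 1, by simp⟩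
  obtain ⟨a', ha', ha'y⟩ := exists_between ha
  obtain ⟨b', hyb', hb'⟩ := exists_between hb
  have hsub : Icc a' b' ⊆ s := by
    intro y hy
    rcases le_total y y₀ with hyy | hyy
    · exact has ⟨ha'.trans_le hy.1, hyy⟩
    · exact hbs ⟨hyy, hy.2.trans_lt hb'⟩
  have hab : a' ≤ b' := (ha'y.trans hyb').le
  -- In either case h takes a value below h y₀ = 0 on one side of y₀.
  rcases (hc.mono hsub).strictMonoOn_of_injOn_Icc' hab (hi.mono hsub) with hm | hm
  · have := hm ⟨le_rfl, hab⟩ ⟨ha'y.le, hyb'.le⟩ ha'y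
    rw [h0] at this
    exact not_lt_zero this
  · have := hm ⟨ha'y.le, hyb'.le⟩ ⟨hab, le_rfl⟩ hyb'
    rw [h0] at this
    exact not_lt_zero this

/-- Local leafwise holomorphic diffeomorphisms preserve the boundary. -/
theorem snd_eq_zero_of_mem_leafwiseGroupoid {E : Type*} [NormedAddCommGroup E] [NormedSpace ℂ E]
    {t : OpenPartialHomeomorph (ModelProd E ℝ≥0) (ModelProd E ℝ≥0)}
    (ht : t ∈ leafwiseGroupoid E) {p : ModelProd E ℝ≥0} (hp : p ∈ t.source) (hp0 : p.2 = 0) :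
    (t p).2 = 0 := by
  by_contra hne
  obtain ⟨v, hv, htv⟩ := ht.1.2.1 p hp
  set c : ℝ≥0 → ModelProd E ℝ≥0 := fun y => ((t p).1, y) with hc
  have hcc : Continuous c := Continuous.prodMk_right (t p).1
  have hcp : c (t p).2 = t p := rfl
  have htp : t p ∈ t.target := t.map_source hp
  have hcont : ContinuousAt (fun y => t.symm (c y)) (t p).2 :=
    ContinuousAt.comp (g := t.symm) (t.symm.continuousAt htp) hcc.continuousAt
  have h1 : c ⁻¹' t.target ∈ 𝓝 (t p).2 :=
    hcc.continuousAt.preimage_mem_nhds (t.open_target.mem_nhds htp)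
  have h2 : (fun y => t.symm (c y)) ⁻¹' v ∈ 𝓝 (t p).2 := by
    refine hcont.preimage_mem_nhds ?_
    change v ∈ 𝓝 (t.symm (t p))
    rwa [t.left_inv hp]
  refine ne_zero_of_eventually_injOn (h := fun y => (t.symm (c y)).2) (pos_iff_ne_zero.2 hne)
    (inter_mem h1 h2) ?_ ?_ ?_
  · exact continuous_snd.comp_continuousOn
      (t.symm.continuousOn.comp hcc.continuousOn fun y hy => hy.1)
  · intro y hy y' hy' h
    have := htv _ hy.2 _ hy'.2 h
    rwa [t.right_inv hy.1, t.right_inv hy'.1] at this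
  · change (t.symm (t p)).2 = 0
    rw [t.left_inv hp, hp0]

theorem Opens.chart_apply {H₀ : Type*} [TopologicalSpace H₀] {U : Opens H₀} (x y : U) :
    chartAt H₀ x y = y := by
  obtain ⟨_, h⟩ := Opens.chart_eq ⟨x⟩ (chart_mem_atlas H₀ x)
  rw [h]
  rfl

/-! ### The restriction homomorphism and its surjectivity -/

namespace HopfConstruction

variable {n : ℕ} (X : HopfConstruction n)

local notation "𝔼" => EuclideanSpace ℂ (Fin n)

theorem boundary_mkH (z : CoverH n) : X.boundary (X.mkH z) = X.mkR (coverBoundary z) := rfl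

theorem T_zpow_coverBoundary_snd (k : ℤ) (z : CoverH n) :
    ((X.T ^ k) (coverBoundary z) : Model n).2 = 0 := by
  rw [← coverBoundary_zpow]
  rfl

theorem exists_coverBoundary_eq {x : CoverR n} (hx : (x : Model n).2 = 0) :
    ∃ z : CoverH n, x = coverBoundary z :=
  ⟨⟨(x : Model n).1, fun h => x.2 (Prod.ext h hx)⟩, Subtype.ext (Prod.ext rfl hx)⟩

/-- Every point of the boundary has a chart-compatible representative on the boundary of the
covering. -/
theorem exists_chartAt_boundary (p : X.H) :
    ∃ z : CoverH n, X.mkH z = p ∧ chartAt (Model n) (X.boundary p) =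
      ((isLocalHomeomorph_quotientMk (Subgroup.zpowers X.T)).localInverseAt
        (coverBoundary z)).trans (chartAt (Model n) (coverBoundary z)) := by
  obtain ⟨x, hx, hchart⟩ :=
    exists_chartAt_quotient_eq (H₀ := Model n) (Subgroup.zpowers X.T) (X.boundary p)
  obtain ⟨w, rfl⟩ : ∃ w, X.mkH w = p := Quotient.exists_rep p
  obtain ⟨⟨_, k, rfl⟩, hk⟩ := Quotient.exact (hx.trans (X.boundary_mkH w))
  obtain ⟨z, rfl⟩ : ∃ z, x = coverBoundary z := by
    refine exists_coverBoundary_eq ?_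
    rw [← hk]
    exact X.T_zpow_coverBoundary_snd k w
  exact ⟨z, X.boundary_injective hx, hchart⟩

/-- An automorphism of the Reeb component lifts locally, near a boundary point, to a holomorphic map
of the boundary. -/
theorem exists_boundary_lift (f : X.R ≃ₜ X.R) (hf : f ∈ X.AutR) (p : X.H) :
    ∃ z : CoverH n, X.mkH z = p ∧ ∃ u : CoverH n → CoverH n,
      ContMDiffAt 𝓘(ℂ, 𝔼) 𝓘(ℂ, 𝔼) ω u z ∧
      ∀ᶠ w in 𝓝 z, f (X.boundary (X.mkH w)) = X.boundary (X.mkH (u w)) := by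
  classical
  obtain ⟨z, hz, hchart⟩ := X.exists_chartAt_boundary p
  obtain ⟨x', -, hchart'⟩ :=
    exists_chartAt_quotient_eq (H₀ := Model n) (Subgroup.zpowers X.T) (f (X.boundary p))
  set hπ := isLocalHomeomorph_quotientMk (Subgroup.zpowers X.T)
  set σ := hπ.localInverseAt (coverBoundary z) with hσ
  set σ' := hπ.localInverseAt x' with hσ'
  set c := chartAt (Model n) (coverBoundary z)
  set c' := chartAt (Model n) x'
  have hc : ∀ y, c y = y := Opens.chart_apply _
  have hc' : ∀ y, c' y = y := Opens.chart_apply _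
  have hσs : ∀ a, σ.symm a = X.mkR a := fun a => congrFun (hπ.localInverseAt_symm _) a
  have hσs' : ∀ a, σ'.symm a = X.mkR a := fun a => congrFun (hπ.localInverseAt_symm _) a
  set e := chartAt (Model n) (X.boundary p)
  set e' := chartAt (Model n) (f (X.boundary p))
  set t := e.symm ≫ₕ f.toOpenPartialHomeomorph ≫ₕ e' with ht
  have htmem : t ∈ leafwiseGroupoid 𝔼 := hf e (chart_mem_atlas _ _) e' (chart_mem_atlas _ _)
  have hesymm : ∀ w : CoverH n, ((w : 𝔼), (0 : ℝ≥0)) ∈ e.target →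
      e.symm ((w : 𝔼), (0 : ℝ≥0)) = X.boundary (X.mkH w) := by
    intro w hw
    rw [hchart] at hw ⊢
    change σ.symm (c.symm ((w : 𝔼), (0 : ℝ≥0))) = _
    rw [hσs, boundary_mkH]
    congr 1
    have := c.right_inv hw.1
    rw [hc] at this
    exact Subtype.ext this
  have hesymm' : ∀ m ∈ e'.target, ∃ h : m ∈ CoverR n, e'.symm m = X.mkR ⟨m, h⟩ := by
    intro m hm
    rw [hchart'] at hm ⊢
    have := c'.right_inv hm.1
    rw [hc'] at this
    have h : m ∈ CoverR n := this ▸ (c'.symm m).2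
    refine ⟨h, ?_⟩
    change σ'.symm (c'.symm m) = _
    rw [hσs']
    congr 1
    exact Subtype.ext this
  set j : 𝔼 → Model n := fun w => (w, 0) with hj
  have hjc : Continuous j := Continuous.prodMk_left (0 : ℝ≥0)
  have hez : e (X.boundary p) = j z := by
    rw [hchart, ← hz, boundary_mkH]
    change c (σ (X.mkR (coverBoundary z))) = _
    rw [show σ (X.mkR (coverBoundary z)) = coverBoundary z from hπ.localInverseAt_apply_self, hc]
    rfl
  have hzt : j z ∈ t.source := by
    rw [← hez]
    refine ⟨e.map_source (mem_chart_source _ _), mem_univ _, ?_⟩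
    change f (e.symm (e (X.boundary p))) ∈ e'.source
    rw [e.left_inv (mem_chart_source _ _)]
    exact mem_chart_source _ _
  set u₀ : 𝔼 → 𝔼 := fun w => (t (j w)).1 with hu₀
  have hu₀d : DifferentiableOn ℂ u₀ (j ⁻¹' t.source) := fun w hw =>
    (htmem.1.2.2 (j w) hw).differentiableWithinAt
  have hopen : IsOpen (j ⁻¹' t.source) := t.open_source.preimage hjc
  -- The groupoid gives only complex differentiability in the leaf direction; Osgood's lemma
  -- upgrades it to analyticity.
  have hu₀a : ContMDiffAt 𝓘(ℂ, 𝔼) 𝓘(ℂ, 𝔼) ω u₀ z :=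
    (hu₀d.analyticOnNhd_of_finiteDimensional hopen z hzt).contDiffAt.contMDiffAt
  have hlift : ∀ w : CoverH n, j w ∈ t.source → ∃ h : u₀ w ∈ CoverH n,
      f (X.boundary (X.mkH w)) = X.boundary (X.mkH ⟨u₀ w, h⟩) := by
    intro w hw
    have h0 : (t (j w)).2 = 0 := snd_eq_zero_of_mem_leafwiseGroupoid htmem hw rfl
    have htarget : t (j w) ∈ e'.target := (t.map_source hw).1.1
    obtain ⟨h, hm⟩ := hesymm' _ htarget
    have hu : u₀ w ∈ CoverH n := fun hu => h (Prod.ext hu h0)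
    refine ⟨hu, ?_⟩
    have h1 : f (X.boundary (X.mkH w)) = e'.symm (t (j w)) := by
      change _ = e'.symm (e' (f (e.symm (j w))))
      have hsource : f (e.symm (j w)) ∈ e'.source := hw.2.2
      rw [e'.left_inv hsource, hesymm w hw.1]
    rw [h1, hm, boundary_mkH]
    congr 1
    exact Subtype.ext (Prod.ext rfl h0)
  have hev : ∀ᶠ w : CoverH n in 𝓝 z, j w ∈ t.source :=
    (hjc.comp continuous_subtype_val).continuousAt.preimage_mem_nhds (t.open_source.mem_nhds hzt)
  -- The default z is used only away from the neighbourhood where `hlift` applies.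
  refine ⟨z, hz, fun w => if h : u₀ w ∈ CoverH n then ⟨u₀ w, h⟩ else z, ?_, ?_⟩
  · rw [← contMDiffAt_subtypeVal_comp_iff]
    refine (contMDiffAt_subtype_iff.2 hu₀a).congr_of_eventuallyEq ?_
    filter_upwards [hev] with w hw
    obtain ⟨h, -⟩ := hlift w hw
    rw [dif_pos h]
  · filter_upwards [hev] with w hw
    obtain ⟨h, hfw⟩ := hlift w hw
    rw [dif_pos h, hfw]

/-- By injectivity of `boundary`, the restriction agrees near each point with the projection of the
holomorphic local lift, hence is holomorphic. -/
theorem exists_contMDiff_restriction (f : X.R ≃ₜ X.R) (hf : f ∈ X.AutR) :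
    ∃ g : X.H → X.H, ContMDiff 𝓘(ℂ, 𝔼) 𝓘(ℂ, 𝔼) ω g ∧
      ∀ p, X.boundary (g p) = f (X.boundary p) := by
  have hex : ∀ p, ∃ p', X.boundary p' = f (X.boundary p) := by
    intro p
    obtain ⟨z, rfl, u, -, hu⟩ := X.exists_boundary_lift f hf p
    exact ⟨_, hu.self_of_nhds.symm⟩
  choose g hg using hex
  refine ⟨g, fun p => ?_, hg⟩
  obtain ⟨z, rfl, u, hus, hu⟩ := X.exists_boundary_lift f hf p
  refine ContMDiffAt.of_comp_quotientMk X.contMDiff_of_mem_zpowers_G₀ ?_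
  refine (ContMDiffAt.comp z (X.contMDiff_mkH (u z)) hus).congr_of_eventuallyEq ?_
  filter_upwards [hu] with w hw
  exact X.boundary_injective ((hg _).trans hw)

theorem exists_restriction (f : X.AutR) :
    ∃ g : X.AutH, ∀ p, X.boundary ((g : X.H ≃ₜ X.H) p) = (f : X.R ≃ₜ X.R) (X.boundary p) := by
  obtain ⟨a, ha, hfa⟩ := X.exists_contMDiff_restriction f f.2
  obtain ⟨b, hb, hfb⟩ := X.exists_contMDiff_restriction (f⁻¹ : X.AutR) (f⁻¹ : X.AutR).2
  have hba : ∀ p, b (a p) = p := fun p => X.boundary_injective <| by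
    rw [hfb, hfa]
    exact (f : X.R ≃ₜ X.R).symm_apply_apply _
  have hab : ∀ p, a (b p) = p := fun p => X.boundary_injective <| by
    rw [hfa, hfb]
    exact (f : X.R ≃ₜ X.R).apply_symm_apply _
  exact ⟨⟨⟨⟨a, b, hba, hab⟩, ha.continuous, hb.continuous⟩, ha, hb⟩, hfa⟩

/-- The restriction homomorphism from the automorphism group of the Reeb component to that of its
boundary Hopf manifold. -/
def restriction : X.AutR →* X.AutH :=
  MonoidHom.mk' (fun f => (X.exists_restriction f).choose) fun f f' => by
    refine Subtype.ext (Homeomorph.ext fun p => X.boundary_injective ?_)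
    rw [(X.exists_restriction (f * f')).choose_spec]
    refine Eq.trans ?_ ((X.exists_restriction f).choose_spec _).symm
    exact congrArg (f : X.R ≃ₜ X.R) ((X.exists_restriction f').choose_spec p).symm

theorem boundary_restriction (f : X.AutR) (p : X.H) :
    X.boundary ((X.restriction f : X.H ≃ₜ X.H) p) = (f : X.R ≃ₜ X.R) (X.boundary p) :=
  (X.exists_restriction f).choose_spec p

theorem zpowers_T_le : Subgroup.zpowers X.T ≤ structureAut (leafwiseGroupoid 𝔼) (CoverR n) := by
  rw [Subgroup.zpowers_le]
  exact puncturedHomeo_mem_structureAut _ _ _ X.GφHomeo_mem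

theorem restriction_surjective (hn : 2 ≤ n) : Function.Surjective X.restriction := by
  rintro ⟨g, hg⟩
  obtain ⟨Φ, hΦ, hgΦ⟩ := X.exists_lift_aut hn g hg
  obtain ⟨F, hF, rfl⟩ := exists_diffeomorph_extension
    (by rw [finrank_euclideanSpace_fin]; exact hn) hΦ
  have hcomm := X.commute_of_lift hn hF hgΦ
  -- Commutation is known off the origin only; at the origin both maps fix 0.
  have hGF : ∀ z : 𝔼, X.G (F z) = F (X.G z) := by
    intro z
    rcases eq_or_ne z 0 with rfl | hz
    · rw [hF, X.G_zero, hF]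
    · exact congrArg Subtype.val (DFunLike.congr_fun hcomm (⟨z, hz⟩ : CoverH n))
  -- The identity on the transverse factor commutes with φ, so F × id commutes with T as soon as F
  -- commutes with G.
  set P : Model n ≃ₜ Model n := F.toHomeomorph.prodCongr (Homeomorph.refl ℝ≥0)
  have hP0 : P (0, 0) = (0, 0) := Prod.ext hF rfl
  have hPmem : P.toOpenPartialHomeomorph ∈ leafwiseGroupoid 𝔼 :=
    ⟨property_prodMap F (Diffeomorph.refl halfLine ℝ≥0 ∞),
      property_prodMap F.symm (Diffeomorph.refl halfLine ℝ≥0 ∞)⟩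
  have hPT : Commute X.T (puncturedHomeo P hP0) :=
    Homeomorph.ext fun x => Subtype.ext (Prod.ext (hGF (x : Model n).1) rfl)
  have hcommP : ∀ γ ∈ Subgroup.zpowers X.T, γ * puncturedHomeo P hP0 = puncturedHomeo P hP0 * γ := by
    rintro _ ⟨k, rfl⟩
    exact hPT.zpow_left k
  have hmem : quotientHomeo _ _ hcommP ∈ X.AutR :=
    quotientHomeo_mem_structureAut _ (leafwiseGroupoid 𝔼) X.zpowers_T_le _ hcommP
      (puncturedHomeo_mem_structureAut _ P hP0 hPmem)
  refine ⟨⟨_, hmem⟩, Subtype.ext (Homeomorph.ext fun p => X.boundary_injective ?_)⟩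
  rw [boundary_restriction]
  obtain ⟨z, rfl⟩ : ∃ z, X.mkH z = p := Quotient.exists_rep p
  rw [← hgΦ]
  rfl

end HopfConstruction

end

theorem proposition4p2 (n : ℕ) (hn : 2 ≤ n) (X : HopfConstruction n) :
    ∃ r : X.AutR →* X.AutH,
      (∀ (f : X.AutR) (p : X.H), X.boundary ((r f : X.H ≃ₜ X.H) p) =
        (f : X.R ≃ₜ X.R) (X.boundary p)) ∧
      Function.Surjective r := by
  exact ⟨X.restriction, X.boundary_restriction, X.restriction_surjective hn⟩
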